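/- Let $G$ be a matrix Lie group, i.e. a closed subgroup of $GL(n,\mathbb R)$ or $GL(n,\mathbb C)$, with Lie algebra $\mathfrak g$, dual $\mathfrak g^*$, exponential map $\exp:\mathfrak g\to G$, left translations $\Phi_g(h)=gh$, and adjoint action $\mathrm{Ad}_g\beta=g\beta g^{-1}$ with dual $\langle \mathrm{Ad}_g^*a,\beta\rangle=\langle a,\mathrm{Ad}_g\beta\rangle$. Fix a horizon $N\ge 1$ and $(\bar q,\bar x)\in G\times\mathbb R^d$. Let $s_t:G\times\mathbb R^d\to G$, $f_t:G\times\mathbb R^d\times\mathbb R^m\to\mathbb R^d$, $c_t:G\times\mathbb R^d\times\mathbb R^m\to\mathbb R$ ($0\le t\le N-1$), $c_N:G\times\mathbb R^d\to\mathbb R$ and $g_t:G\times\mathbb R^d\to\mathbb R^{r}$ ($1\le t\le N$) be smooth, let $U_t\subset\mathbb R^m$ be convex and compact, and let $F_t:\mathbb R^m\to\mathbb R^{\ell}$ be linear ($0\le t\le N-1$). Assume that there is an open set $O\subset\mathfrak g$ such that $\exp:O\to\exp(O)$ is a diffeomorphism onto an open subset of $G$ and every $s_t$ takes values in $\exp(O)$;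 $\exp^{-1}$ denotes the inverse of this diffeomorphism. Consider the problem of minimizing $$\sum_{t=0}^{N-1}c_t(q_t,x_t,u_t)+c_N(q_N,x_N)$$ subject to $q_{t+1}=q_t\,s_t(q_t,x_t)$, $x_{t+1}=f_t(q_t,x_t,u_t)$, $u_t\in U_t$ for $0\le t\le N-1$; $g_t(q_t,x_t)\le 0$ (componentwise) for $1\le t\le N$; $(q_0,x_0)=(\bar q,\bar x)$; and $\sum_{t=0}^{N-1}F_tu_t=0$. For $\eta\in\mathbb R$, $\hat\eta\in\mathbb R^\ell$, $\zeta\in\mathfrak g^*$, $\xi\in\mathbb R^d$ put $$H^{\eta,\hat\eta}(\zeta,\xi,t,q,x,u)=\eta\,c_t(q,x,u)+\langle\zeta,\exp^{-1}(s_t(q,x))\rangle+\langle\xi,f_t(q,x,u)\rangle+\langle\hat\eta,F_tu\rangle .$$ Let $(u_t)_{t=0}^{N-1}$ be an optimal control trajectory and $(q_t,x_t)_{t=0}^{N}$ the corresponding state trajectory. Then there exist $\zeta_t\in\mathfrak g^*$ and $\xi_t\in\mathbb R^d$ ($0\le t\le N-1$), $\mu_t\in\mathbb R^{r}$ ($1\le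 t\le N$), $\eta\in\{-1,0\}$ and $\hat\eta\in\mathbb R^\ell$ such that, with $\gamma_t=(\zeta_t,\xi_t,t,q_t,x_t,u_t)$, $H=H^{\eta,\hat\eta}$, $h_t=\exp(D_\zeta H(\gamma_t))$ and $\rho_t=\bigl(D(\exp^{-1})(h_t)\circ T_e\Phi_{h_t}\bigr)^*\zeta_t\in\mathfrak g^*$, the following hold. (i) Non-triviality: the multipliers $(\xi_t)_t,(\zeta_t)_t,\eta,\hat\eta,(\mu_t)_t$ do not all vanish. Moreover, if the state constraints are nondegenerate along $(q_t,x_t)$, meaning that for each $1\le t\le N$ the only $\nu\in\mathbb R^{r}$ with $\nu\le0$, $\nu^{(j)}g_t^{(j)}(q_t,x_t)=0$ for all $j$, and $\nu D_qg_t(q_t,x_t)=0$, $\nu D_xg_t(q_t,x_t)=0$ is $\nu=0$, then already $(\xi_t)_t,(\zeta_t)_t,\eta,\hat\eta$ do not all vanish. (ii) State and adjoint dynamics: for $0\le t\le N-1$, $q_{t+1}=q_t\exp(D_\zeta H(\gamma_t))$ and $x_{t+1}=D_\xi H(\gamma_t)$; for $1\le t\le N-1$, $$\rho_{t-1}=T_e^*\Phi_{q_t}\bigl(D_qH(\gamma_t)+\mu_tD_qg_t(q_t,x_t)\bigr)+\mathrm{Ad}^*_{\exp(-D_\zeta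 H(\gamma_t))}\rho_t,\qquad \xi_{t-1}=D_xH(\gamma_t)+\mu_tD_xg_t(q_t,x_t).$$ (iii) Transversality: $\rho_{N-1}=T_e^*\Phi_{q_N}\bigl(\eta D_qc_N(q_N,x_N)+\mu_ND_qg_N(q_N,x_N)\bigr)$ and $\xi_{N-1}=\eta D_xc_N(q_N,x_N)+\mu_ND_xg_N(q_N,x_N)$. (iv) $\langle D_uH(\gamma_t),v-u_t\rangle\le0$ for all $v\in U_t$ and $0\le t\le N-1$. (v) Complementary slackness: $\mu_t^{(j)}g_t^{(j)}(q_t,x_t)=0$ for all $j$ and $1\le t\le N$. (vi) Non-positivity: $\mu_t\le0$ (componentwise) for $1\le t\le N$. -/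

import Mathlib

-- Matrices carry the operator norm induced by the sup norm; smoothness does not depend on it.
open scoped ContDiff Topology Matrix.Norms.Operator

noncomputable section

namespace LiePMP

/-- Real coordinate space with its Euclidean inner product. -/
abbrev E (k : ℕ) : Type := EuclideanSpace ℝ (Fin k)

/-! ### Matrix Lie groups, their exponential map and their Lie algebra

Everything in this section is written for a finite-dimensional real unital algebra `A` with a
submultiplicative norm. It is used with `A` the algebra of `n × n` matrices over `ℝ` or `ℂ`, so
that `Aˣ` is the general linear group. -/

section MatrixGroups

variable {A : Type*} [NormedRing A] [NormedAlgebra ℝ A] [FiniteDimensional ℝ A]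

/-- A matrix Lie group: a closed subgroup of the group of invertible matrices. -/
abbrev MatrixLieGroup (A : Type*) [NormedRing A] : Type _ := ClosedSubgroup Aˣ

/-- The matrix exponential, as an invertible matrix. -/
def expUnit (X : A) : Aˣ where
  val := NormedSpace.exp X
  inv := NormedSpace.exp (-X)
  val_inv := by
    let _ := NormedAlgebra.restrictScalars ℚ ℝ A
    have := FiniteDimensional.complete ℝ A
    rw [← NormedSpace.exp_add_of_commute (Commute.neg_right (Commute.refl X)), add_neg_cancel,
      NormedSpace.exp_zero]
  inv_val := by
    let _ := NormedAlgebra.restrictScalars ℚ ℝ A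
    have := FiniteDimensional.complete ℝ A
    rw [← NormedSpace.exp_add_of_commute (Commute.neg_left (Commute.refl X)), neg_add_cancel,
      NormedSpace.exp_zero]

theorem continuous_expUnit : Continuous (expUnit : A → Aˣ) := by
  let _ := NormedAlgebra.restrictScalars ℚ ℝ A
  have := FiniteDimensional.complete ℝ A
  rw [Units.continuous_iff]
  exact ⟨NormedSpace.exp_continuous, NormedSpace.exp_continuous.comp continuous_neg⟩

theorem expUnit_zero : expUnit (0 : A) = 1 := Units.ext NormedSpace.exp_zero

theorem expUnit_nsmul (k : ℕ) (X : A) : expUnit (k • X) = expUnit X ^ k := by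
  let _ := NormedAlgebra.restrictScalars ℚ ℝ A
  have := FiniteDimensional.complete ℝ A
  exact Units.ext (by rw [Units.val_pow_eq_pow_val]; exact NormedSpace.exp_nsmul k X)

theorem expUnit_conj (g : Aˣ) (X : A) :
    expUnit ((g : A) * X * ((g⁻¹ : Aˣ) : A)) = g * expUnit X * g⁻¹ := by
  let _ := NormedAlgebra.restrictScalars ℚ ℝ A
  have := FiniteDimensional.complete ℝ A
  exact Units.ext (NormedSpace.exp_units_conj g X)

/-- If `k • Z k → W` and the exponentials of all `Z k` lie in a closed subgroup, then so does the
exponential of `W`. -/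
theorem expUnit_mem_of_tendsto (G : MatrixLieGroup A) {Z : ℕ → A} {W : A}
    (hZ : ∀ᶠ k in Filter.atTop, expUnit (Z k) ∈ G.toSubgroup)
    (hlim : Filter.Tendsto (fun k : ℕ => k • Z k) Filter.atTop (𝓝 W)) :
    expUnit W ∈ G.toSubgroup := by
  have h1 : Filter.Tendsto (fun k : ℕ => expUnit (k • Z k)) Filter.atTop (𝓝 (expUnit W)) :=
    (continuous_expUnit.tendsto W).comp hlim
  refine G.isClosed'.mem_of_tendsto h1 ?_
  filter_upwards [hZ] with k hk
  rw [expUnit_nsmul]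
  exact G.toSubgroup.pow_mem hk k

/-- Two exponentials multiply, to first order, like the exponential of the sum. -/
theorem expUnit_add_mem (G : MatrixLieGroup A) {X Y : A}
    (hX : ∀ t : ℝ, expUnit (t • X) ∈ G.toSubgroup)
    (hY : ∀ t : ℝ, expUnit (t • Y) ∈ G.toSubgroup) :
    expUnit (X + Y) ∈ G.toSubgroup := by
  let _ := NormedAlgebra.restrictScalars ℚ ℝ A
  have := FiniteDimensional.complete ℝ A
  have hexp : HasStrictFDerivAt (NormedSpace.exp : A → A)
      ((ContinuousLinearEquiv.refl ℝ A : A ≃L[ℝ] A) : A →L[ℝ] A) 0 :=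
    hasStrictFDerivAt_exp_zero
  set L : A → A := hexp.localInverse with hL
  have hLd : HasStrictFDerivAt L (ContinuousLinearMap.id ℝ A) (1 : A) := by
    have := hexp.to_localInverse
    rw [NormedSpace.exp_zero] at this
    exact this
  have hL1 : L 1 = 0 := by
    have := hexp.localInverse_apply_image
    rwa [NormedSpace.exp_zero] at this
  have hright : ∀ᶠ y in 𝓝 (1 : A), NormedSpace.exp (L y) = y := by
    have := hexp.eventually_right_inverse
    rwa [NormedSpace.exp_zero] at this
  have hd : ∀ V : A, HasDerivAt (fun h : ℝ => NormedSpace.exp (h • V)) V 0 := by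
    intro V
    have h2 : HasFDerivAt (NormedSpace.exp : A → A) (ContinuousLinearMap.id ℝ A)
        ((0 : ℝ) • V) := by
      rw [zero_smul]; exact hexp.hasFDerivAt
    have h3 : HasDerivAt (fun h : ℝ => h • V) V 0 := by
      simpa using (hasDerivAt_id (0 : ℝ)).smul_const V
    exact h2.comp_hasDerivAt (0 : ℝ) h3
  have hprod : HasDerivAt (fun h : ℝ => NormedSpace.exp (h • X) * NormedSpace.exp (h • Y))
      (X + Y) 0 := by
    have h5 := (hd X).mul (hd Y)
    simp only [zero_smul, NormedSpace.exp_zero, mul_one, one_mul] at h5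
    exact h5
  have hp0 : NormedSpace.exp ((0 : ℝ) • X) * NormedSpace.exp ((0 : ℝ) • Y) = (1 : A) := by simp
  have hZ : HasDerivAt
      (fun h : ℝ => L (NormedSpace.exp (h • X) * NormedSpace.exp (h • Y))) (X + Y) 0 := by
    have h4 : HasFDerivAt L (ContinuousLinearMap.id ℝ A)
        (NormedSpace.exp ((0 : ℝ) • X) * NormedSpace.exp ((0 : ℝ) • Y)) := by
      rw [hp0]; exact hLd.hasFDerivAt
    exact h4.comp_hasDerivAt (0 : ℝ) hprod
  have hseq : Filter.Tendsto (fun k : ℕ => ((k : ℝ))⁻¹) Filter.atTop (𝓝[≠] 0) := by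
    refine tendsto_nhdsWithin_iff.2 ⟨tendsto_inv_atTop_nhds_zero_nat, ?_⟩
    filter_upwards [Filter.eventually_gt_atTop 0] with k hk
    have : (k : ℝ) ≠ 0 := by exact_mod_cast hk.ne'
    simpa using this
  refine expUnit_mem_of_tendsto G
    (Z := fun k : ℕ =>
      L (NormedSpace.exp (((k : ℝ))⁻¹ • X) * NormedSpace.exp (((k : ℝ))⁻¹ • Y))) ?_ ?_
  · have hc : Filter.Tendsto
        (fun k : ℕ => NormedSpace.exp (((k : ℝ))⁻¹ • X) * NormedSpace.exp (((k : ℝ))⁻¹ • Y))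
        Filter.atTop (𝓝 (1 : A)) := by
      have := hprod.continuousAt.tendsto.comp (hseq.mono_right nhdsWithin_le_nhds)
      rwa [hp0] at this
    filter_upwards [hc.eventually hright] with k hk
    have : expUnit (L (NormedSpace.exp (((k : ℝ))⁻¹ • X) * NormedSpace.exp (((k : ℝ))⁻¹ • Y)))
        = expUnit (((k : ℝ))⁻¹ • X) * expUnit (((k : ℝ))⁻¹ • Y) := Units.ext hk
    rw [this]
    exact G.toSubgroup.mul_mem (hX _) (hY _)
  · have := (hasDerivAt_iff_tendsto_slope_zero.1 hZ).comp hseq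
    refine this.congr fun k => ?_
    simp [hL1, Nat.cast_smul_eq_nsmul]

/-- The Lie algebra of a matrix Lie group: the matrices `X` whose one-parameter group
`t ↦ exp (t X)` stays in the group. -/
def lieAlg (G : MatrixLieGroup A) : Submodule ℝ A where
  carrier := {X | ∀ t : ℝ, expUnit (t • X) ∈ G.toSubgroup}
  zero_mem' := fun t => by
    rw [smul_zero, expUnit_zero]; exact G.toSubgroup.one_mem
  add_mem' := fun {X Y} hX hY t => by
    rw [smul_add]
    refine expUnit_add_mem G (fun r => ?_) (fun r => ?_)
    · rw [smul_smul]; exact hX _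
    · rw [smul_smul]; exact hY _
  smul_mem' := fun c X hX t => by
    rw [smul_smul]; exact hX _

/-- The exponential map from the Lie algebra to the group. -/
def expG (G : MatrixLieGroup A) (X : lieAlg G) : G.toSubgroup :=
  ⟨expUnit (X : A), by simpa using X.2 1⟩

/-- The matrix underlying a group element. -/
def toMat (G : MatrixLieGroup A) (q : G.toSubgroup) : A := ((q : Aˣ) : A)

/-- The adjoint action `X ↦ g X g⁻¹` of the group on its Lie algebra. -/
def Ad (G : MatrixLieGroup A) (g : G.toSubgroup) : lieAlg G →L[ℝ] lieAlg G :=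
  LinearMap.toContinuousLinearMap
    { toFun := fun X => ⟨((g : Aˣ) : A) * (X : A) * (((g : Aˣ)⁻¹ : Aˣ) : A), fun t => by
        have h : t • (((g : Aˣ) : A) * (X : A) * (((g : Aˣ)⁻¹ : Aˣ) : A))
            = ((g : Aˣ) : A) * (t • (X : A)) * (((g : Aˣ)⁻¹ : Aˣ) : A) := by
          simp only [mul_smul_comm, smul_mul_assoc]
        rw [h, expUnit_conj]
        exact G.toSubgroup.mul_mem (G.toSubgroup.mul_mem g.2 (X.2 t)) (G.toSubgroup.inv_mem g.2)⟩
      map_add' := fun X Y => Subtype.ext (by simp [mul_add, add_mul])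
      map_smul' := fun c X => Subtype.ext (by simp) }

/-- The dual `Ad_g^*` of the adjoint action: `⟨Ad_g^* a, β⟩ = ⟨a, Ad_g β⟩`. The coadjoint action of
`g` is `Ad_{g⁻¹}^*`. -/
def AdDual (G : MatrixLieGroup A) (g : G.toSubgroup) (a : lieAlg G →L[ℝ] ℝ) : lieAlg G →L[ℝ] ℝ :=
  a.comp (Ad G g)

/-- Smoothness at the point `p` of a function on a space `X` sitting in a normed space `V` through
`ι` as an embedded submanifold: near `p` the function is the restriction of a map that is smooth at
`ι p` on the ambient space. -/
def SmoothAlongAt {X V F : Type*} [TopologicalSpace X] [NormedAddCommGroup V] [NormedSpace ℝ V]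
    [NormedAddCommGroup F] [NormedSpace ℝ F] (ι : X → V) (f : X → F) (p : X) : Prop :=
  ∃ f' : V → F, ContDiffAt ℝ ∞ f' (ι p) ∧ ∀ᶠ y in 𝓝 p, f y = f' (ι y)

/-- Smooth functions on `G × W`, for a normed space `W`. -/
def SmoothOnProd (G : MatrixLieGroup A) {W F : Type*} [NormedAddCommGroup W] [NormedSpace ℝ W]
    [NormedAddCommGroup F] [NormedSpace ℝ F] (f : G.toSubgroup × W → F) : Prop :=
  ∀ p, SmoothAlongAt (fun y : G.toSubgroup × W => (toMat G y.1, y.2)) f p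

/-- The left-trivialized derivative `T_e^* Φ_q (D_q h(q)) : 𝔤 → F` of `h : G → F` at `q`, where
`Φ_q` is left translation by `q`. It sends `X` to the derivative of `h` at `q` along the tangent
vector `q X`, and it is computed in the exponential coordinates `X ↦ q exp X` at `q`, whose
derivative at `0` is `X ↦ q X`. -/
def trivDeriv (G : MatrixLieGroup A) {F : Type*} [NormedAddCommGroup F] [NormedSpace ℝ F]
    (h : G.toSubgroup → F) (q : G.toSubgroup) : lieAlg G →L[ℝ] F :=
  fderiv ℝ (fun X : lieAlg G => h (q * expG G X)) 0

/-- The inverse of the exponential map restricted to the set `O` (used only on `exp O`, for `O` on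
which the exponential map is injective). -/
def logOn (G : MatrixLieGroup A) (O : Set (lieAlg G)) : G.toSubgroup → lieAlg G :=
  Function.invFunOn (expG G) O

/-- `O` is an open set on which the exponential map is a diffeomorphism onto its image, an open
subset of the group. (The exponential map itself is always smooth.) -/
structure IsExpDiffeoOn (G : MatrixLieGroup A) (O : Set (lieAlg G)) : Prop where
  isOpen : IsOpen O
  injOn : Set.InjOn (expG G) O
  isOpen_image : IsOpen (expG G '' O)
  smooth_inv : ∀ h ∈ expG G '' O, SmoothAlongAt (toMat G) (logOn G O) h

/-- The left-trivialized derivative `D(exp⁻¹)(h) ∘ T_e Φ_h : 𝔤 → 𝔤` of the inverse `exp⁻¹` of the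
exponential map on `O`, at the point `h` of `exp O`. -/
def dlogOn (G : MatrixLieGroup A) (O : Set (lieAlg G)) (h : G.toSubgroup) :
    lieAlg G →L[ℝ] lieAlg G :=
  trivDeriv G (logOn G O) h

end MatrixGroups

/-- The derivative at `a` of a function `φ` on the dual of a finite-dimensional space `V`, as a
vector of `V` (identified with its bidual). -/
def dualGrad {V : Type*} [NormedAddCommGroup V] [NormedSpace ℝ V] [FiniteDimensional ℝ V]
    (φ : (V →L[ℝ] ℝ) → ℝ) (a : V →L[ℝ] ℝ) : V :=
  (Module.evalEquiv ℝ V).symm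
    ((fderiv ℝ φ a : (V →L[ℝ] ℝ) →ₗ[ℝ] ℝ) ∘ₗ
      (LinearMap.toContinuousLinearMap : (V →ₗ[ℝ] ℝ) ≃ₗ[ℝ] (V →L[ℝ] ℝ)).toLinearMap)

theorem apply_dualGrad {V : Type*} [NormedAddCommGroup V] [NormedSpace ℝ V]
    [FiniteDimensional ℝ V] (φ : (V →L[ℝ] ℝ) → ℝ) (a b : V →L[ℝ] ℝ) :
    b (dualGrad φ a) = fderiv ℝ φ a b := by
  have h := Module.apply_evalEquiv_symm_apply ℝ V (b : V →ₗ[ℝ] ℝ)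
    ((fderiv ℝ φ a : (V →L[ℝ] ℝ) →ₗ[ℝ] ℝ) ∘ₗ
      (LinearMap.toContinuousLinearMap : (V →ₗ[ℝ] ℝ) ≃ₗ[ℝ] (V →L[ℝ] ℝ)).toLinearMap)
  exact h

/-! ### The optimal control problem -/

section Problem

variable {A : Type*} [NormedRing A] [NormedAlgebra ℝ A] [FiniteDimensional ℝ A]

/-- The data of the optimal control problem: minimize
`∑_{t < N} c t (q_t, x_t, u_t) + cN (q_N, x_N)` subject to
`q_{t+1} = q_t s t (q_t, x_t)`, `x_{t+1} = f t (q_t, x_t, u_t)`, `u_t ∈ U t` for `0 ≤ t < N`,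
`g t (q_t, x_t) ≤ 0` for `1 ≤ t ≤ N`, `(q_0, x_0) = (qInit, xInit)` and `∑_{t < N} F t u_t = 0`.
Time-dependent data are indexed by `ℕ`; only the stages just listed matter. -/
structure ControlProblem (G : MatrixLieGroup A) (d m r l : ℕ) where
  /-- the time horizon -/
  N : ℕ
  /-- the integration step on the group -/
  s : ℕ → G.toSubgroup × E d → G.toSubgroup
  /-- the dynamics of the vector state -/
  f : ℕ → G.toSubgroup × (E d × E m) → E d
  /-- the stage costs -/
  c : ℕ → G.toSubgroup × (E d × E m) → ℝ
  /-- the final cost -/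
  cN : G.toSubgroup × E d → ℝ
  /-- the state constraints -/
  g : ℕ → G.toSubgroup × E d → E r
  /-- the sets of admissible controls -/
  U : ℕ → Set (E m)
  /-- the matrices of the frequency constraint -/
  F : ℕ → E m →L[ℝ] E l
  /-- the initial configuration -/
  qInit : G.toSubgroup
  /-- the initial vector state -/
  xInit : E d

variable {G : MatrixLieGroup A} {d m r l : ℕ}

/-- The standing assumptions on the data: a positive horizon, smooth dynamics, costs and state
constraints, and convex compact sets of admissible controls. -/
structure ControlProblem.IsRegular (P : ControlProblem G d m r l) : Prop where
  N_pos : 0 < P.N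
  smooth_s : ∀ t < P.N, SmoothOnProd G (fun p => toMat G (P.s t p))
  smooth_f : ∀ t < P.N, SmoothOnProd G (P.f t)
  smooth_c : ∀ t < P.N, SmoothOnProd G (P.c t)
  smooth_cN : SmoothOnProd G P.cN
  smooth_g : ∀ t, 1 ≤ t → t ≤ P.N → SmoothOnProd G (P.g t)
  convex_U : ∀ t < P.N, Convex ℝ (P.U t)
  compact_U : ∀ t < P.N, IsCompact (P.U t)

/-- Feasible state and control trajectories. -/
structure ControlProblem.IsFeasible (P : ControlProblem G d m r l)
    (q : ℕ → G.toSubgroup) (x : ℕ → E d) (u : ℕ → E m) : Prop where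
  init_q : q 0 = P.qInit
  init_x : x 0 = P.xInit
  step_q : ∀ t < P.N, q (t + 1) = q t * P.s t (q t, x t)
  step_x : ∀ t < P.N, x (t + 1) = P.f t (q t, x t, u t)
  control : ∀ t < P.N, u t ∈ P.U t
  state : ∀ t, 1 ≤ t → t ≤ P.N → ∀ j, P.g t (q t, x t) j ≤ 0
  freq : ∑ t ∈ Finset.range P.N, P.F t (u t) = 0

/-- The cost of a trajectory. -/
def ControlProblem.cost (P : ControlProblem G d m r l)
    (q : ℕ → G.toSubgroup) (x : ℕ → E d) (u : ℕ → E m) : ℝ :=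
  ∑ t ∈ Finset.range P.N, P.c t (q t, x t, u t) + P.cN (q P.N, x P.N)

/-- Optimal trajectories: feasible, and no feasible trajectory has a smaller cost. -/
def ControlProblem.IsOptimal (P : ControlProblem G d m r l)
    (q : ℕ → G.toSubgroup) (x : ℕ → E d) (u : ℕ → E m) : Prop :=
  P.IsFeasible q x u ∧
    ∀ q' x' u', P.IsFeasible q' x' u' → P.cost q x u ≤ P.cost q' x' u'

/-- The Hamiltonian `η c_t(q,x,u) + ⟨ζ, exp⁻¹(s_t(q,x))⟩ + ⟨ξ, f_t(q,x,u)⟩ + ⟨ηF, F_t u⟩`, with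
`ζ` in the dual of the Lie algebra and `exp⁻¹` taken on `exp O`. -/
def ControlProblem.H (P : ControlProblem G d m r l) (O : Set (lieAlg G)) (η : ℝ) (ηF : E l)
    (ζ : lieAlg G →L[ℝ] ℝ) (ξ : E d) (t : ℕ) (q : G.toSubgroup) (x : E d) (u : E m) : ℝ :=
  η * P.c t (q, x, u) + ζ (logOn G O (P.s t (q, x))) + inner ℝ ξ (P.f t (q, x, u))
    + inner ℝ ηF (P.F t u)

/-- `D_ζ H`, an element of the Lie algebra. -/
def ControlProblem.DζH (P : ControlProblem G d m r l) (O : Set (lieAlg G)) (η : ℝ) (ηF : E l)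
    (ζ : lieAlg G →L[ℝ] ℝ) (ξ : E d) (t : ℕ) (q : G.toSubgroup) (x : E d) (u : E m) : lieAlg G :=
  dualGrad (fun z => P.H O η ηF z ξ t q x u) ζ

/-- The state constraints are nondegenerate along a trajectory: at each stage, no nontrivial
nonpositive combination of the differentials of the active constraints vanishes. -/
def ControlProblem.NondegenerateConstraints (P : ControlProblem G d m r l)
    (q : ℕ → G.toSubgroup) (x : ℕ → E d) : Prop :=
  ∀ t, 1 ≤ t → t ≤ P.N → ∀ ν : E r, (∀ j, ν j ≤ 0) → (∀ j, ν j * P.g t (q t, x t) j = 0) →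
    trivDeriv G (fun p => inner ℝ ν (P.g t (p, x t))) (q t) = 0 →
    gradient (fun y => inner ℝ ν (P.g t (q t, y))) (x t) = 0 → ν = 0

/-- The conditions of the maximum principle along the trajectory `(q, x, u)`, for the adjoint
trajectories `ζ` (in the dual of the Lie algebra) and `ξ`, the covectors `μ` of the state
constraints, and the constant multipliers `η` of the cost and `ηF` of the frequency constraint.
The covector `ρ_t = (D(exp⁻¹)(h_t) ∘ T_e Φ_{h_t})^* ζ_t`, with `h_t = exp (D_ζ H)` at stage `t`, is
the argument `ρ`. -/
structure ControlProblem.IsExtremal (P : ControlProblem G d m r l) (O : Set (lieAlg G))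
    (q : ℕ → G.toSubgroup) (x : ℕ → E d) (u : ℕ → E m)
    (ζ ρ : ℕ → lieAlg G →L[ℝ] ℝ) (ξ : ℕ → E d) (μ : ℕ → E r) (η : ℝ) (ηF : E l) : Prop where
  /-- the definition of `ρ` -/
  rho_eq : ∀ t < P.N, ρ t =
    (ζ t).comp (dlogOn G O (expG G (P.DζH O η ηF (ζ t) (ξ t) t (q t) (x t) (u t))))
  /-- the multipliers do not all vanish -/
  nontrivial : ¬ ((∀ t < P.N, ξ t = 0) ∧ (∀ t < P.N, ζ t = 0) ∧ η = 0 ∧ ηF = 0 ∧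
    (∀ t, 1 ≤ t → t ≤ P.N → μ t = 0))
  /-- if the state constraints are nondegenerate, then already the adjoint trajectories and the
  multipliers of the cost and of the frequency constraint do not all vanish -/
  nontrivial_of_nondegenerate : P.NondegenerateConstraints q x →
    ¬ ((∀ t < P.N, ξ t = 0) ∧ (∀ t < P.N, ζ t = 0) ∧ η = 0 ∧ ηF = 0)
  /-- the state dynamics on the group -/
  state_q : ∀ t < P.N,
    q (t + 1) = q t * expG G (P.DζH O η ηF (ζ t) (ξ t) t (q t) (x t) (u t))
  /-- the dynamics of the vector state -/
  state_x : ∀ t < P.N,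
    x (t + 1) = gradient (fun y => P.H O η ηF (ζ t) y t (q t) (x t) (u t)) (ξ t)
  /-- the adjoint dynamics on the dual of the Lie algebra -/
  adjoint_q : ∀ t, 1 ≤ t → t < P.N → ρ (t - 1) =
    trivDeriv G (fun p => P.H O η ηF (ζ t) (ξ t) t p (x t) (u t)) (q t)
      + trivDeriv G (fun p => inner ℝ (μ t) (P.g t (p, x t))) (q t)
      + AdDual G (expG G (-(P.DζH O η ηF (ζ t) (ξ t) t (q t) (x t) (u t)))) (ρ t)
  /-- the adjoint dynamics of the vector state -/
  adjoint_x : ∀ t, 1 ≤ t → t < P.N → ξ (t - 1) =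
    gradient (fun y => P.H O η ηF (ζ t) (ξ t) t (q t) y (u t)) (x t)
      + gradient (fun y => inner ℝ (μ t) (P.g t (q t, y))) (x t)
  /-- transversality on the dual of the Lie algebra -/
  transversality_q : ρ (P.N - 1) =
    η • trivDeriv G (fun p => P.cN (p, x P.N)) (q P.N)
      + trivDeriv G (fun p => inner ℝ (μ P.N) (P.g P.N (p, x P.N))) (q P.N)
  /-- transversality of the vector state -/
  transversality_x : ξ (P.N - 1) =
    η • gradient (fun y => P.cN (q P.N, y)) (x P.N)
      + gradient (fun y => inner ℝ (μ P.N) (P.g P.N (q P.N, y))) (x P.N)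
  /-- the variational inequality for the control -/
  hamiltonian_le : ∀ t < P.N, ∀ v ∈ P.U t,
    inner ℝ (gradient (fun w => P.H O η ηF (ζ t) (ξ t) t (q t) (x t) w) (u t)) (v - u t) ≤ 0
  /-- complementary slackness -/
  slackness : ∀ t, 1 ≤ t → t ≤ P.N → ∀ j, μ t j * P.g t (q t, x t) j = 0
  /-- non-positivity -/
  nonpos : ∀ t, 1 ≤ t → t ≤ P.N → ∀ j, μ t j ≤ 0

end Problem

end LiePMP

end

/-!
The controls determine the states, so the problem is one of minimizing over the convex set of
admissible controls, under the inequalities given by the state constraints and one linear equation.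
An optimum satisfies the Fritz John rule (`exists_fritzJohn_multipliers`). To prove the rule,
linearize the cost and the constraints in the direction of each admissible control. The values
strictly exceeding these linearizations, together with the values of the linear equation, form a
convex set in a finite-dimensional space. It misses the origin by optimality: the linear equation
persists along segments, so no constraint qualification is needed. A functional separating the set
from the origin is the multiplier, and evaluating at the optimum itself gives complementary
slackness.

It remains to express the derivative of the Lagrangian in the controls through costates.
Variations of the group component of the state are left-trivialized, hence live in the Lie algebra.
That the velocity of `s_t` along a curve is tangent to the group needs no theorem on closed
subgroups: `log s_t` is a smooth function with values in the Lie algebra, and the derivative of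
`exp` at `log h` inverts the left-trivialized derivative of `log` at `h`
(`IsExpDiffeoOn.fderiv_exp_dlogOn`). This identity also makes `dlogOn` invertible, so that the
adjoint equation for `ρ_t`, which is solved backwards, determines `ζ_t`. Pairing the costates with
the variation and summing by parts (`ControlProblem.sum_gradient_control`) identifies the
derivative of the Lagrangian with the sum over `t` of the derivatives of the Hamiltonian in `u_t`;
varying a single `u_t` gives the variational inequality.

If the adjoint trajectories and the multipliers of the cost and of the frequency constraint vanish,
the adjoint and transversality equations reduce to the vanishing of the differential of `μ_t g_t`,
and nondegeneracy gives `μ_t = 0`, which the Fritz John rule excludes.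
-/

open scoped ContDiff Topology Matrix.Norms.Operator

noncomputable section

namespace LiePMP

/-! ### Separation and the Fritz John multiplier rule -/

/-- In finite dimension no interior point is needed to separate a nonempty convex set from a point
outside it: a convex set with empty interior lies in a hyperplane. -/
theorem exists_ne_zero_forall_le_zero {V : Type*} [NormedAddCommGroup V] [NormedSpace ℝ V]
    [FiniteDimensional ℝ V] {S : Set V} (hS : Convex ℝ S) (hne : S.Nonempty)
    (h0 : (0 : V) ∉ S) : ∃ φ : V →L[ℝ] ℝ, φ ≠ 0 ∧ ∀ x ∈ S, φ x ≤ 0 := by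
  by_cases hint : (interior S).Nonempty
  · obtain ⟨φ, hφ, h⟩ := geometric_hahn_banach_of_nonempty_interior_point hS
      (fun h => h0 (interior_subset h)) hint
    exact ⟨φ, hφ, fun x hx => by simpa using h x hx⟩
  · rw [hS.interior_nonempty_iff_affineSpan_eq_top,
      ← AffineSubspace.direction_eq_top_iff_of_nonempty (hne.affineSpan ℝ)] at hint
    obtain ⟨ψ, hψ, hker⟩ := Submodule.exists_le_ker_of_lt_top _ (lt_top_iff_ne_top.2 hint)
    obtain ⟨x₀, hx₀⟩ := hne
    have hconst : ∀ x ∈ S, ψ x = ψ x₀ := fun x hx => by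
      have : ψ (x -ᵥ x₀) = 0 := hker (AffineSubspace.vsub_mem_direction
        (subset_affineSpan ℝ S hx) (subset_affineSpan ℝ S hx₀))
      rwa [vsub_eq_sub, map_sub, sub_eq_zero] at this
    have hψ' : ψ.toContinuousLinearMap ≠ 0 := fun h =>
      hψ (LinearMap.ext fun y => by simpa using DFunLike.congr_fun h y)
    rcases le_total (ψ x₀) 0 with h | h
    · exact ⟨ψ.toContinuousLinearMap, hψ', fun x hx => by simpa [hconst x hx] using h⟩
    · exact ⟨-ψ.toContinuousLinearMap, neg_ne_zero.2 hψ', fun x hx => by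
        simpa [hconst x hx] using h⟩

/-- The Fritz John multiplier rule for minimizing `J` over a convex set, under inequality
constraints `g i ≤ 0` and a linear constraint `L = 0`. Only derivatives along lines are needed, so
the space of variables carries no topology. -/
theorem exists_fritzJohn_multipliers {V W ι : Type*} [AddCommGroup V] [Module ℝ V]
    [NormedAddCommGroup W] [InnerProductSpace ℝ W] [FiniteDimensional ℝ W] [Fintype ι]
    {K : Set V} (hK : Convex ℝ K) {u : V} (hu : u ∈ K)
    {J : V → ℝ} {J' : V →ₗ[ℝ] ℝ} {g : ι → V → ℝ} {g' : ι → V →ₗ[ℝ] ℝ} {L : V →ₗ[ℝ] W}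
    (hJ : ∀ v, HasDerivAt (fun ε : ℝ => J (u + ε • v)) (J' v) 0)
    (hg : ∀ i v, HasDerivAt (fun ε : ℝ => g i (u + ε • v)) (g' i v) 0)
    (hLu : L u = 0) (hgu : ∀ i, g i u ≤ 0)
    (hmin : ∀ w ∈ K, (∀ i, g i w ≤ 0) → L w = 0 → J u ≤ J w) :
    ∃ (η : ℝ) (μ : ι → ℝ) (ν : W), (η = -1 ∨ η = 0) ∧ (∀ i, μ i ≤ 0) ∧
      (∀ i, μ i * g i u = 0) ∧ ¬ (η = 0 ∧ (∀ i, μ i = 0) ∧ ν = 0) ∧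
      ∀ v ∈ K, η * J' (v - u) + ∑ i, μ i * g' i (v - u) + inner ℝ ν (L (v - u)) ≤ 0 := by
  classical
  have := FiniteDimensional.complete ℝ W
  let S : Set (ℝ × (ι → ℝ) × W) := {p | ∃ v ∈ K, J' (v - u) < p.1 ∧
    (∀ i, g i u + g' i (v - u) < p.2.1 i) ∧ L (v - u) = p.2.2}
  have hSne : S.Nonempty := ⟨(1, fun i => g i u + 1, 0), u, hu, by simp, by simp, by simp⟩
  have hSconv : Convex ℝ S := by
    rintro ⟨a, b, c⟩ ⟨v, hv, h1, h2, h3⟩ ⟨a', b', c'⟩ ⟨v', hv', h1', h2', h3'⟩ s t hs ht hst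
    have hd : s • v + t • v' - u = s • (v - u) + t • (v' - u) := by
      have : u = s • u + t • u := by rw [← add_smul, hst, one_smul]
      nth_rewrite 1 [this]
      module
    have key : ∀ {x y x' y' : ℝ}, x < y → x' < y' → s * x + t * x' < s * y + t * y' := by
      intro x y x' y' h h'
      rcases hs.eq_or_lt with rfl | hs
      · have : t = 1 := by linarith
        subst this; linarith
      · have := mul_lt_mul_of_pos_left h hs
        have := mul_le_mul_of_nonneg_left h'.le ht
        linarith
    refine ⟨s • v + t • v', hK hv hv' hs ht hst, ?_, fun i => ?_, ?_⟩
    · rw [hd]; simpa using key h1 h1'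
    · rw [hd]
      have := key (h2 i) (h2' i)
      have e : g i u = s * g i u + t * g i u := by rw [← add_mul, hst, one_mul]
      simp only [map_add, map_smul, smul_eq_mul, Prod.smul_mk, Prod.mk_add_mk, Pi.add_apply,
        Pi.smul_apply] at this ⊢
      linarith
    · rw [hd]
      simp only at h3 h3'
      simp [h3, h3']
  have hS0 : (0 : ℝ × (ι → ℝ) × W) ∉ S := by
    rintro ⟨v, hv, h1, h2, h3⟩
    simp only [Prod.fst_zero, Prod.snd_zero, Pi.zero_apply] at h1 h2 h3
    have hlin : ∀ {φ : ℝ → ℝ} {φ' : ℝ} {b : ℝ}, HasDerivAt φ φ' 0 → φ' < b →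
        ∀ᶠ ε in 𝓝[>] (0 : ℝ), φ ε < φ 0 + ε * b := by
      intro φ φ' b hφ hb
      filter_upwards [hφ.tendsto_slope_zero_right.eventually_lt_const hb, self_mem_nhdsWithin]
        with ε hε (hpos : 0 < ε)
      rw [smul_eq_mul, inv_mul_lt_iff₀ hpos, zero_add] at hε
      linarith
    have hJe := hlin (hJ (v - u)) h1
    have hge := Filter.eventually_all.2 fun i => hlin (b := - g i u) (hg i (v - u))
      (by linarith [h2 i])
    have h01 : ∀ᶠ ε in 𝓝[>] (0 : ℝ), ε ∈ Set.Ioo (0 : ℝ) 1 := Ioo_mem_nhdsGT one_pos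
    obtain ⟨ε, h4, h5, h6, h7⟩ := (hJe.and (hge.and h01)).exists
    simp only [zero_smul, add_zero, mul_zero] at h4 h5
    refine absurd (hmin (u + ε • (v - u)) (hK.add_smul_sub_mem hu hv ⟨h6.le, h7.le⟩)
      (fun i => ?_) (by simp [hLu, h3])) (not_le.2 h4)
    nlinarith [h5 i, hgu i]
  obtain ⟨φ, hφ, hφS⟩ := exists_ne_zero_forall_le_zero hSconv hSne hS0
  -- the components of the separating functional
  set η : ℝ := φ (1, 0, 0) with hη
  set μ : ι → ℝ := fun i => φ (0, Pi.single i 1, 0) with hμ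
  set ν : W := (InnerProductSpace.toDual ℝ W).symm
    (φ.comp ((ContinuousLinearMap.inr ℝ ℝ ((ι → ℝ) × W)).comp
      (ContinuousLinearMap.inr ℝ (ι → ℝ) W))) with hν
  have hrep : ∀ a b c, φ (a, b, c) = η * a + ∑ i, μ i * b i + inner ℝ ν c := by
    intro a b c
    have e1 : ((a, b, c) : ℝ × (ι → ℝ) × W)
        = a • (1, 0, 0) + (∑ i, b i • ((0, Pi.single i 1, 0) : ℝ × (ι → ℝ) × W)) + (0, 0, c) := by
      refine Prod.ext ?_ (Prod.ext ?_ ?_)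
      · simp [Prod.fst_sum]
      · ext j
        simp [Prod.fst_sum, Prod.snd_sum, Finset.sum_apply, Pi.single_apply]
      · simp [Prod.snd_sum]
    rw [e1, map_add, map_add, map_smul, map_sum, hν, InnerProductSpace.toDual_symm_apply]
    simp only [map_smul, smul_eq_mul, hη, hμ, mul_comm, ContinuousLinearMap.comp_apply,
      ContinuousLinearMap.inr_apply]
  have hne : ¬ (η = 0 ∧ (∀ i, μ i = 0) ∧ ν = 0) := by
    rintro ⟨h1, h2, h3⟩
    refine hφ (ContinuousLinearMap.ext fun p => ?_)
    rw [show p = (p.1, p.2.1, p.2.2) from rfl, hrep]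
    simp [h1, h2, h3]
  -- moving up in the first components shows that the multipliers are nonpositive
  have hup : ∀ {α β : ℝ}, (∀ s : ℝ, 0 < s → α + s * β ≤ 0) → β ≤ 0 := by
    intro α β h
    by_contra! hβ
    have := h ((|α| + 1) / β) (by positivity)
    rw [div_mul_cancel₀ _ hβ.ne'] at this
    linarith [neg_abs_le α]
  have hη0 : η ≤ 0 := by
    refine hup (α := φ (0, fun i => g i u + 1, 0)) fun s hs => ?_
    have := hφS (s, fun i => g i u + 1, 0) ⟨u, hu, by simpa using hs, by simp, by simp⟩
    rw [hrep] at this ⊢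
    linarith
  have hμ0 : ∀ i, μ i ≤ 0 := fun i => by
    refine hup (α := φ (1, fun i => g i u + 1, 0)) fun s hs => ?_
    have := hφS (1, (fun i => g i u + 1) + s • Pi.single i 1, 0)
      ⟨u, hu, by simp, fun j => by
        by_cases h : j = i
        · subst h; simp; linarith
        · simp [h], by simp⟩
    have e : φ (1, (fun i => g i u + 1) + s • Pi.single i 1, 0)
        = φ (1, fun i => g i u + 1, 0) + s * μ i := by
      rw [hμ, ← smul_eq_mul, ← map_smul, ← map_add]
      simp
    linarith
  -- letting the strict inequalities become equalities
  have hle : ∀ v ∈ K, η * J' (v - u) + ∑ i, μ i * (g i u + g' i (v - u))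
      + inner ℝ ν (L (v - u)) ≤ 0 := by
    intro v hv
    have hs : ∀ s : ℝ, 0 < s → η * J' (v - u) + ∑ i, μ i * (g i u + g' i (v - u))
        + inner ℝ ν (L (v - u)) + s * (η + ∑ i, μ i) ≤ 0 := by
      intro s hs
      have := hφS (J' (v - u) + s, fun i => g i u + g' i (v - u) + s, L (v - u))
        ⟨v, hv, by simpa using hs, fun _ => by simpa using hs, rfl⟩
      rw [hrep] at this
      simp only [mul_add, Finset.sum_add_distrib, Finset.mul_sum] at this ⊢
      simp only [mul_comm s]
      linarith
    refine le_of_forall_pos_le_add fun δ hδ => ?_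
    have hM : 0 ≤ -(η + ∑ i, μ i) := by
      linarith [Finset.sum_nonpos fun i (_ : i ∈ Finset.univ) => hμ0 i]
    have h1 := hs (δ / (-(η + ∑ i, μ i) + 1)) (by positivity)
    have h2 : δ / (-(η + ∑ i, μ i) + 1) * (-(η + ∑ i, μ i)) ≤ δ := by
      rw [div_mul_eq_mul_div, div_le_iff₀ (by positivity)]
      nlinarith
    linarith
  have hslack : ∀ i, μ i * g i u = 0 := by
    have h1 : ∀ i ∈ Finset.univ, 0 ≤ μ i * g i u := fun i _ =>
      mul_nonneg_of_nonpos_of_nonpos (hμ0 i) (hgu i)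
    have h2 : ∑ i, μ i * g i u ≤ 0 := by simpa using hle u hu
    have h3 := (Finset.sum_eq_zero_iff_of_nonneg h1).1 (le_antisymm h2 (Finset.sum_nonneg h1))
    exact fun i => h3 i (Finset.mem_univ i)
  have hvar : ∀ v ∈ K, η * J' (v - u) + ∑ i, μ i * g' i (v - u) + inner ℝ ν (L (v - u)) ≤ 0 := by
    intro v hv
    simpa [mul_add, hslack] using hle v hv
  rcases hη0.eq_or_lt with h0 | h0
  · exact ⟨η, μ, ν, Or.inr h0, hμ0, hslack, hne, hvar⟩
  · -- normalize the multiplier of the cost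
    have hc : 0 < (-η)⁻¹ := inv_pos.2 (neg_pos.2 h0)
    refine ⟨-1, fun i => (-η)⁻¹ * μ i, (-η)⁻¹ • ν, Or.inl rfl,
      fun i => mul_nonpos_of_nonneg_of_nonpos hc.le (hμ0 i),
      fun i => by rw [mul_assoc, hslack, mul_zero], by simp, fun v hv => ?_⟩
    have h1 := mul_nonpos_of_nonneg_of_nonpos hc.le (hvar v hv)
    have h2 : (-η)⁻¹ * η = -1 := by rw [inv_neg, neg_mul, inv_mul_cancel₀ h0.ne]
    rw [mul_add, mul_add, ← mul_assoc, h2, Finset.mul_sum] at h1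
    rw [real_inner_smul_left]
    simpa only [mul_assoc] using h1

/-! ### Calculus on a matrix Lie group -/

section Calculus

variable {A : Type*} [NormedRing A] {G : MatrixLieGroup A}

theorem toMat_mul (g h : G.toSubgroup) : toMat G (g * h) = toMat G g * toMat G h := rfl

theorem toMat_inv_mul_cancel (g : G.toSubgroup) : toMat G g⁻¹ * toMat G g = 1 := by
  rw [← toMat_mul, inv_mul_cancel]; rfl

theorem toMat_mul_inv_cancel (g : G.toSubgroup) : toMat G g * toMat G g⁻¹ = 1 := by
  rw [← toMat_mul, mul_inv_cancel]; rfl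

theorem toMat_mul_left_injective (g : G.toSubgroup) :
    Function.Injective fun X : A => toMat G g * X := fun X Y h => by
  have := congrArg (toMat G g⁻¹ * ·) h
  simpa only [← mul_assoc, toMat_inv_mul_cancel, one_mul] using this

variable [NormedAlgebra ℝ A]
  {F W W' : Type*} [NormedAddCommGroup F] [NormedSpace ℝ F] [NormedAddCommGroup W]
  [NormedSpace ℝ W] [NormedAddCommGroup W'] [NormedSpace ℝ W']

/-- Freezing the vector variable. -/
theorem SmoothAlongAt.fst {f : G.toSubgroup × W → F} {q : G.toSubgroup} {w : W}
    (hf : SmoothAlongAt (fun y : G.toSubgroup × W => (toMat G y.1, y.2)) f (q, w)) :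
    SmoothAlongAt (toMat G) (fun p => f (p, w)) q := by
  obtain ⟨f', hf', he⟩ := hf
  refine ⟨fun a => f' (a, w), hf'.comp (toMat G q) (contDiffAt_id.prodMk contDiffAt_const), ?_⟩
  exact (Continuous.tendsto (by fun_prop : Continuous fun p : G.toSubgroup => (p, w)) q).eventually
    he

theorem SmoothAlongAt.contDiffAt_snd {f : G.toSubgroup × W → F} {q : G.toSubgroup} {w : W}
    (hf : SmoothAlongAt (fun y : G.toSubgroup × W => (toMat G y.1, y.2)) f (q, w)) :
    ContDiffAt ℝ ∞ (fun y => f (q, y)) w := by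
  obtain ⟨f', hf', he⟩ := hf
  have h : ContDiffAt ℝ ∞ (fun y => f' (toMat G q, y)) w :=
    hf'.comp w (contDiffAt_const.prodMk contDiffAt_id)
  exact h.congr_of_eventuallyEq
    ((Continuous.tendsto (by fun_prop : Continuous fun y : W => (q, y)) w).eventually he)

variable [FiniteDimensional ℝ A]

theorem isInducing_toMat (G : MatrixLieGroup A) : Topology.IsInducing (toMat G) := by
  have := FiniteDimensional.complete ℝ A
  exact Units.isOpenEmbedding_val.isInducing.comp Topology.IsInducing.subtypeVal

theorem toMat_expG (X : lieAlg G) : toMat G (expG G X) = NormedSpace.exp (X : A) := rfl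

theorem coe_Ad (g : G.toSubgroup) (X : lieAlg G) :
    (Ad G g X : A) = toMat G g * X * toMat G g⁻¹ := rfl

theorem expG_zero : expG G 0 = 1 := Subtype.ext expUnit_zero

theorem expG_neg (X : lieAlg G) : expG G (-X) = (expG G X)⁻¹ := by
  refine Subtype.ext (Units.ext ?_)
  rfl

theorem continuous_expG : Continuous (expG G) :=
  (continuous_expUnit.comp continuous_subtype_val).subtype_mk _

theorem SmoothAlongAt.comp {X V Y V' : Type*} [TopologicalSpace X] [NormedAddCommGroup V]
    [NormedSpace ℝ V] [TopologicalSpace Y] [NormedAddCommGroup V'] [NormedSpace ℝ V']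
    {ι : X → V} {κ : Y → V'} {φ : X → Y} {f : Y → F} {p : X} (hκ : Topology.IsInducing κ)
    (hι : ContinuousAt ι p)
    (hf : SmoothAlongAt κ f (φ p)) (hφ : SmoothAlongAt ι (fun y => κ (φ y)) p) :
    SmoothAlongAt ι (fun y => f (φ y)) p := by
  obtain ⟨f', hf', hfe⟩ := hf
  obtain ⟨φ', hφ', hφe⟩ := hφ
  have hp : κ (φ p) = φ' (ι p) := hφe.self_of_nhds
  have hc : ContinuousAt φ p := by
    rw [hκ.continuousAt_iff]
    exact (hφ'.continuousAt.comp hι).congr (hφe.mono fun y hy => hy.symm)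
  refine ⟨f' ∘ φ', ContDiffAt.comp _ (hp ▸ hf') hφ', ?_⟩
  filter_upwards [hφe, hc.eventually hfe] with y h1 h2
  rw [h2, h1, Function.comp_apply]

/-- The curve `γ` in the group has velocity `γ(0) X` at time `0`. -/
def HasVelocity (γ : ℝ → G.toSubgroup) (X : lieAlg G) : Prop :=
  HasDerivAt (fun ε => toMat G (γ ε)) (toMat G (γ 0) * X) 0

theorem HasVelocity.continuousAt {γ : ℝ → G.toSubgroup} {X : lieAlg G} (h : HasVelocity γ X) :
    ContinuousAt γ 0 :=
  (isInducing_toMat G).continuousAt_iff.2 (HasDerivAt.continuousAt h)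

theorem hasVelocity_const (q : G.toSubgroup) : HasVelocity (fun _ => q) (0 : lieAlg G) := by
  simpa [HasVelocity] using hasDerivAt_const (0 : ℝ) (toMat G q)

/-- Left-trivialized product rule. -/
theorem HasVelocity.mul {γ κ : ℝ → G.toSubgroup} {X Y : lieAlg G} (hγ : HasVelocity γ X)
    (hκ : HasVelocity κ Y) :
    HasVelocity (fun ε => γ ε * κ ε) (Ad G (κ 0)⁻¹ X + Y) := by
  have h := HasDerivAt.mul hγ hκ
  unfold HasVelocity
  refine h.congr_deriv ?_
  rw [toMat_mul, Submodule.coe_add, coe_Ad, inv_inv]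
  simp only [mul_add, ← mul_assoc]
  rw [mul_assoc (toMat G (γ 0)) (toMat G (κ 0)) (toMat G (κ 0)⁻¹), toMat_mul_inv_cancel, mul_one]

theorem differentiableAt_exp (X : A) : DifferentiableAt ℝ (NormedSpace.exp : A → A) X := by
  let _ := NormedAlgebra.restrictScalars ℚ ℝ A
  have := FiniteDimensional.complete ℝ A
  exact (NormedSpace.exp_analytic (𝕂 := ℝ) X).differentiableAt

theorem hasFDerivAt_toMat_expG_zero (q : G.toSubgroup) :
    HasFDerivAt (fun X : lieAlg G => toMat G (q * expG G X))
      ((ContinuousLinearMap.mul ℝ A (toMat G q)).comp (lieAlg G).subtypeL) 0 := by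
  let _ := NormedAlgebra.restrictScalars ℚ ℝ A
  have := FiniteDimensional.complete ℝ A
  have h1 : HasFDerivAt (NormedSpace.exp : A → A) (ContinuousLinearMap.id ℝ A)
      ((lieAlg G).subtypeL 0) := hasStrictFDerivAt_exp_zero.hasFDerivAt
  have h2 := h1.comp (0 : lieAlg G) (lieAlg G).subtypeL.hasFDerivAt
  exact (ContinuousLinearMap.mul ℝ A (toMat G q)).hasFDerivAt.comp (0 : lieAlg G) h2

theorem SmoothAlongAt.hasFDerivAt_expG {f : G.toSubgroup → F} {q : G.toSubgroup}
    (hf : SmoothAlongAt (toMat G) f q) :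
    HasFDerivAt (fun X : lieAlg G => f (q * expG G X)) (trivDeriv G f q) 0 := by
  obtain ⟨f', hf', he⟩ := hf
  have h0 : q * expG G 0 = q := by rw [expG_zero, mul_one]
  have hc : Filter.Tendsto (fun X : lieAlg G => q * expG G X) (𝓝 0) (𝓝 q) := by
    have : Continuous fun X : lieAlg G => q * expG G X := continuous_const.mul continuous_expG
    simpa only [h0] using this.tendsto 0
  have h1 : HasFDerivAt f' (fderiv ℝ f' (toMat G q)) (toMat G (q * expG G 0)) := by
    rw [h0]; exact (hf'.differentiableAt (by simp)).hasFDerivAt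
  have h2 := (h1.comp (0 : lieAlg G) (hasFDerivAt_toMat_expG_zero q)).congr_of_eventuallyEq
    (hc.eventually he)
  exact h2.differentiableAt.hasFDerivAt

/-- The left-trivialized derivative in terms of a smooth extension to the ambient algebra. -/
theorem trivDeriv_apply_eq {f : G.toSubgroup → F} {f' : A → F} {q : G.toSubgroup}
    (hf' : DifferentiableAt ℝ f' (toMat G q)) (he : ∀ᶠ p in 𝓝 q, f p = f' (toMat G p))
    (X : lieAlg G) : trivDeriv G f q X = fderiv ℝ f' (toMat G q) (toMat G q * X) := by
  have h0 : q * expG G 0 = q := by rw [expG_zero, mul_one]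
  have hc : Filter.Tendsto (fun X : lieAlg G => q * expG G X) (𝓝 0) (𝓝 q) := by
    have : Continuous fun X : lieAlg G => q * expG G X := continuous_const.mul continuous_expG
    simpa only [h0] using this.tendsto 0
  have h1 : HasFDerivAt f' (fderiv ℝ f' (toMat G q)) (toMat G (q * expG G 0)) := by
    rw [h0]; exact hf'.hasFDerivAt
  have h2 := (h1.comp (0 : lieAlg G) (hasFDerivAt_toMat_expG_zero q)).congr_of_eventuallyEq
    (hc.eventually he)
  rw [trivDeriv, h2.fderiv]
  rfl

/-- The derivative of `f : G × W → F` at `(q, w)`, left-trivialized in the group variable and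
assembled from the partial derivatives. -/
def totalDeriv (f : G.toSubgroup × W → F) (q : G.toSubgroup) (w : W) : lieAlg G × W →L[ℝ] F :=
  (trivDeriv G (fun p => f (p, w)) q).coprod (fderiv ℝ (fun y => f (q, y)) w)

/-- The derivative of `f : G × (W × W') → F` at `(q, w, v)`, left-trivialized in the group variable
and assembled from the three partial derivatives. -/
def totalDeriv₃ (f : G.toSubgroup × (W × W') → F) (q : G.toSubgroup) (w : W) (v : W') :
    (lieAlg G × W) × W' →L[ℝ] F :=
  ((trivDeriv G (fun p => f (p, w, v)) q).coprod (fderiv ℝ (fun y => f (q, y, v)) w)).coprod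
    (fderiv ℝ (fun z => f (q, w, z)) v)

/-- The chain rule along a curve in `G × W`. -/
theorem SmoothAlongAt.hasDerivAt_comp {f : G.toSubgroup × W → F} {γ : ℝ → G.toSubgroup}
    {σ : ℝ → W} {X : lieAlg G} {w' : W} {q : G.toSubgroup} {w : W}
    (hf : SmoothAlongAt (fun y : G.toSubgroup × W => (toMat G y.1, y.2)) f (q, w))
    (hq : γ 0 = q) (hw : σ 0 = w) (hγ : HasVelocity γ X) (hσ : HasDerivAt σ w' 0) :
    HasDerivAt (fun ε => f (γ ε, σ ε)) (totalDeriv f q w (X, w')) 0 := by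
  subst hq hw
  rw [totalDeriv, ContinuousLinearMap.coprod_apply]
  obtain ⟨f', hf', he⟩ := hf
  have hd : DifferentiableAt ℝ f' (toMat G (γ 0), σ 0) := hf'.differentiableAt (by simp)
  have hcurve := hd.hasFDerivAt.comp_hasDerivAt (0 : ℝ) (HasDerivAt.prodMk hγ hσ)
  have hev : (fun ε => f (γ ε, σ ε)) =ᶠ[𝓝 0] f' ∘ fun ε => (toMat G (γ ε), σ ε) :=
    (hγ.continuousAt.prodMk hσ.continuousAt).eventually he
  refine (hcurve.congr_of_eventuallyEq hev).congr_deriv ?_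
  have h1 : HasFDerivAt (fun a => f' (a, σ 0)) _ (toMat G (γ 0)) :=
    hd.hasFDerivAt.comp (f := fun a => (a, σ 0)) _ (hasFDerivAt_prodMk_left _ _)
  have h2 : HasFDerivAt (fun y => f' (toMat G (γ 0), y)) _ (σ 0) :=
    hd.hasFDerivAt.comp (f := fun y => (toMat G (γ 0), y)) _ (hasFDerivAt_prodMk_right _ _)
  have e1 := (Continuous.tendsto
    (by fun_prop : Continuous fun p : G.toSubgroup => (p, σ 0)) (γ 0)).eventually he
  have e2 := (Continuous.tendsto
    (by fun_prop : Continuous fun y : W => (γ 0, y)) (σ 0)).eventually he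
  rw [trivDeriv_apply_eq h1.differentiableAt e1, h1.fderiv,
    (h2.congr_of_eventuallyEq e2).fderiv]
  simp [← map_add]

/-- The chain rule along a curve in `G × (W × W')`, with the derivative split into its three
partial derivatives. -/
theorem SmoothAlongAt.hasDerivAt_comp₃ {f : G.toSubgroup × (W × W') → F} {γ : ℝ → G.toSubgroup}
    {σ : ℝ → W} {τ : ℝ → W'} {X : lieAlg G} {w' : W} {v' : W'} {q : G.toSubgroup} {w : W} {v : W'}
    (hf : SmoothAlongAt (fun y : G.toSubgroup × (W × W') => (toMat G y.1, y.2)) f (q, w, v))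
    (hq : γ 0 = q) (hw : σ 0 = w) (hv : τ 0 = v)
    (hγ : HasVelocity γ X) (hσ : HasDerivAt σ w' 0) (hτ : HasDerivAt τ v' 0) :
    HasDerivAt (fun ε => f (γ ε, σ ε, τ ε)) (totalDeriv₃ f q w v ((X, w'), v')) 0 := by
  subst hq hw hv
  refine (SmoothAlongAt.hasDerivAt_comp (σ := fun ε => (σ ε, τ ε)) hf rfl rfl hγ
    (hσ.prodMk hτ)).congr_deriv ?_
  rw [totalDeriv, totalDeriv₃, ContinuousLinearMap.coprod_apply, ContinuousLinearMap.coprod_apply,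
    ContinuousLinearMap.coprod_apply]
  have hd : DifferentiableAt ℝ (fun y => f (γ 0, y)) (σ 0, τ 0) :=
    hf.contDiffAt_snd.differentiableAt (by simp)
  have h1 : HasFDerivAt (fun y => f (γ 0, y, τ 0)) _ (σ 0) :=
    hd.hasFDerivAt.comp (f := fun y => (y, τ 0)) _ (hasFDerivAt_prodMk_left _ _)
  have h2 : HasFDerivAt (fun v => f (γ 0, σ 0, v)) _ (τ 0) :=
    hd.hasFDerivAt.comp (f := fun v => (σ 0, v)) _ (hasFDerivAt_prodMk_right _ _)
  rw [h1.fderiv, h2.fderiv, add_assoc]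
  simp [← map_add]

/-! ### The logarithm -/

section Log

variable {O : Set (lieAlg G)}

theorem expG_logOn {h : G.toSubgroup} (hh : h ∈ expG G '' O) : expG G (logOn G O h) = h :=
  Function.invFunOn_eq hh

/-- The derivative of `exp` at `log h` inverts the left-trivialized derivative of `log` at `h`. -/
theorem IsExpDiffeoOn.fderiv_exp_dlogOn (hO : IsExpDiffeoOn G O) {h : G.toSubgroup}
    (hh : h ∈ expG G '' O) (X : lieAlg G) :
    fderiv ℝ (NormedSpace.exp : A → A) (logOn G O h) (dlogOn G O h X) = toMat G h * X := by
  have h0 : h * expG G 0 = h := by rw [expG_zero, mul_one]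
  have h1 : HasFDerivAt (fun X : lieAlg G => ((logOn G O (h * expG G X) : lieAlg G) : A))
      ((lieAlg G).subtypeL.comp (dlogOn G O h)) 0 :=
    (lieAlg G).subtypeL.hasFDerivAt.comp (0 : lieAlg G) (hO.smooth_inv h hh).hasFDerivAt_expG
  have h2 : HasFDerivAt (NormedSpace.exp : A → A)
      (fderiv ℝ (NormedSpace.exp : A → A) (logOn G O h : A)) (logOn G O (h * expG G 0) : A) := by
    rw [h0]; exact (differentiableAt_exp _).hasFDerivAt
  have h3 := h2.comp (0 : lieAlg G) h1
  have hc : Filter.Tendsto (fun X : lieAlg G => h * expG G X) (𝓝 0) (𝓝 h) := by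
    have : Continuous fun X : lieAlg G => h * expG G X := continuous_const.mul continuous_expG
    simpa only [h0] using this.tendsto 0
  have h4 : (fun X : lieAlg G => toMat G (h * expG G X)) =ᶠ[𝓝 0]
      (NormedSpace.exp : A → A) ∘ fun X : lieAlg G =>
        ((logOn G O (h * expG G X) : lieAlg G) : A) := by
    filter_upwards [hc.eventually (hO.isOpen_image.mem_nhds hh)] with X hX
    rw [Function.comp_apply, ← toMat_expG, expG_logOn hX]
  have h5 := (h3.congr_of_eventuallyEq h4).unique (hasFDerivAt_toMat_expG_zero h)
  exact DFunLike.congr_fun h5 X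

theorem IsExpDiffeoOn.exists_equiv_dlogOn (hO : IsExpDiffeoOn G O) {h : G.toSubgroup}
    (hh : h ∈ expG G '' O) :
    ∃ e : lieAlg G ≃L[ℝ] lieAlg G, (e : lieAlg G →L[ℝ] lieAlg G) = dlogOn G O h := by
  have hinj : Function.Injective (dlogOn G O h : lieAlg G →ₗ[ℝ] lieAlg G) := fun X Y hXY => by
    have h1 := hO.fderiv_exp_dlogOn hh X
    have hXY' : dlogOn G O h X = dlogOn G O h Y := hXY
    rw [hXY', hO.fderiv_exp_dlogOn hh Y] at h1
    exact Subtype.ext (toMat_mul_left_injective h h1).symm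
  exact ⟨(LinearEquiv.ofInjectiveEndo _ hinj).toContinuousLinearEquiv, by ext; rfl⟩

theorem IsExpDiffeoOn.dlogOn_comp_inverse (hO : IsExpDiffeoOn G O) {h : G.toSubgroup}
    (hh : h ∈ expG G '' O) :
    (dlogOn G O h).comp (dlogOn G O h).inverse = ContinuousLinearMap.id ℝ _ := by
  obtain ⟨e, he⟩ := hO.exists_equiv_dlogOn hh
  rw [← he, ContinuousLinearMap.inverse_equiv]
  exact e.coe_comp_coe_symm

theorem IsExpDiffeoOn.inverse_comp_dlogOn (hO : IsExpDiffeoOn G O) {h : G.toSubgroup}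
    (hh : h ∈ expG G '' O) :
    (dlogOn G O h).inverse.comp (dlogOn G O h) = ContinuousLinearMap.id ℝ _ := by
  obtain ⟨e, he⟩ := hO.exists_equiv_dlogOn hh
  rw [← he, ContinuousLinearMap.inverse_equiv]
  exact e.coe_symm_comp_coe

/-- A curve in `exp O` has a velocity as soon as its logarithm is differentiable. This is where
tangent vectors of the group are seen to come from its Lie algebra. -/
theorem IsExpDiffeoOn.hasVelocity (hO : IsExpDiffeoOn G O) {κ : ℝ → G.toSubgroup}
    (hκ : ∀ ε, κ ε ∈ expG G '' O) {Y : lieAlg G}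
    (h : HasDerivAt (fun ε => logOn G O (κ ε)) Y 0) :
    HasVelocity κ ((dlogOn G O (κ 0)).inverse Y) := by
  have h1 : HasDerivAt (fun ε => ((logOn G O (κ ε) : lieAlg G) : A)) (Y : A) 0 :=
    (lieAlg G).subtypeL.hasFDerivAt.comp_hasDerivAt (0 : ℝ) h
  have h2 := (differentiableAt_exp (logOn G O (κ 0) : A)).hasFDerivAt.comp_hasDerivAt (0 : ℝ) h1
  have h3 : (fun ε => toMat G (κ ε))
      = (NormedSpace.exp : A → A) ∘ fun ε => ((logOn G O (κ ε) : lieAlg G) : A) := by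
    funext ε
    rw [Function.comp_apply, ← toMat_expG, expG_logOn (hκ ε)]
  rw [HasVelocity, h3, ← hO.fderiv_exp_dlogOn (hκ 0)]
  have h4 := DFunLike.congr_fun (hO.dlogOn_comp_inverse (hκ 0)) Y
  rw [ContinuousLinearMap.comp_apply, ContinuousLinearMap.id_apply] at h4
  rwa [h4]

end Log

end Calculus

section Principle

variable {A : Type*} [NormedRing A] {G : MatrixLieGroup A} {d m r l : ℕ}
  {P : ControlProblem G d m r l}

/-! ### Trajectories and their first variation -/

/-- The state trajectory driven by a sequence of controls. -/
def ControlProblem.traj (P : ControlProblem G d m r l) (w : ℕ → E m) : ℕ → G.toSubgroup × E d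
  | 0 => (P.qInit, P.xInit)
  | t + 1 => ((P.traj w t).1 * P.s t (P.traj w t), P.f t ((P.traj w t).1, (P.traj w t).2, w t))

theorem ControlProblem.IsFeasible.traj_eq {q : ℕ → G.toSubgroup} {x : ℕ → E d} {u : ℕ → E m}
    (h : P.IsFeasible q x u) : ∀ t ≤ P.N, P.traj u t = (q t, x t)
  | 0, _ => by rw [ControlProblem.traj, h.init_q, h.init_x]
  | t + 1, ht => by
    rw [ControlProblem.traj, h.traj_eq t (by omega), h.step_q t ht, h.step_x t ht]

/-- The trajectory driven by admissible controls is feasible if it meets the state and frequency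
constraints. -/
theorem ControlProblem.isFeasible_traj {w : ℕ → E m} (hU : ∀ t < P.N, w t ∈ P.U t)
    (hg : ∀ t < P.N, ∀ j, P.g (t + 1) (P.traj w (t + 1)) j ≤ 0)
    (hF : ∑ t ∈ Finset.range P.N, P.F t (w t) = 0) :
    P.IsFeasible (fun t => (P.traj w t).1) (fun t => (P.traj w t).2) w where
  init_q := rfl
  init_x := rfl
  step_q _ _ := rfl
  step_x _ _ := rfl
  control := hU
  state t h1 h2 j := by
    obtain ⟨k, rfl⟩ : ∃ k, t = k + 1 := ⟨t - 1, by omega⟩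
    exact hg k (by omega) j
  freq := hF

variable [NormedAlgebra ℝ A] [FiniteDimensional ℝ A] {O : Set (lieAlg G)}

/-- The linearized dynamics at stage `t`, acting on left-trivialized variations of the state and
variations of the control. The term with `dlogOn⁻¹` turns the variation of `log s_t` into the
left-trivialized variation of `s_t`. -/
def ControlProblem.linStep (P : ControlProblem G d m r l) (O : Set (lieAlg G)) (t : ℕ)
    (q : G.toSubgroup) (x : E d) (u : E m) : (lieAlg G × E d) × E m →L[ℝ] lieAlg G × E d :=
  ((Ad G (P.s t (q, x))⁻¹).comp
      ((ContinuousLinearMap.fst ℝ _ _).comp (ContinuousLinearMap.fst ℝ _ _))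
    + (dlogOn G O (P.s t (q, x))).inverse.comp
      ((totalDeriv (fun p => logOn G O (P.s t p)) q x).comp (ContinuousLinearMap.fst ℝ _ _))).prod
    (totalDeriv₃ (P.f t) q x u)

/-- The first variation of the state along a reference trajectory, as a linear function of the
variation of the controls; its group component is left-trivialized. -/
def ControlProblem.variation (P : ControlProblem G d m r l) (O : Set (lieAlg G))
    (q : ℕ → G.toSubgroup) (x : ℕ → E d) (u : ℕ → E m) :
    ℕ → ((ℕ → E m) →ₗ[ℝ] lieAlg G × E d)
  | 0 => 0
  | t + 1 => (P.linStep O t (q t) (x t) (u t)).toLinearMap ∘ₗ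
      (P.variation O q x u t).prod (LinearMap.proj t)

theorem ControlProblem.variation_succ (q : ℕ → G.toSubgroup) (x : ℕ → E d) (u v : ℕ → E m)
    (t : ℕ) : P.variation O q x u (t + 1) v
      = P.linStep O t (q t) (x t) (u t) (P.variation O q x u t v, v t) := rfl

theorem ControlProblem.IsRegular.smooth_log (hP : P.IsRegular) (hO : IsExpDiffeoOn G O)
    (hs : ∀ t < P.N, Set.range (P.s t) ⊆ expG G '' O) {t : ℕ} (ht : t < P.N) :
    SmoothOnProd G (fun p => logOn G O (P.s t p)) := fun p =>
  SmoothAlongAt.comp (isInducing_toMat G)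
    (((isInducing_toMat G).continuous.comp continuous_fst).prodMk continuous_snd).continuousAt
    (hO.smooth_inv _ (hs t ht ⟨p, rfl⟩)) (hP.smooth_s t ht p)

/-- The variation is the derivative of the state with respect to the controls. -/
theorem ControlProblem.hasDerivAt_traj (hP : P.IsRegular) (hO : IsExpDiffeoOn G O)
    (hs : ∀ t < P.N, Set.range (P.s t) ⊆ expG G '' O) {q : ℕ → G.toSubgroup} {x : ℕ → E d}
    {u : ℕ → E m} (h : P.IsFeasible q x u) (v : ℕ → E m) :
    ∀ t ≤ P.N, HasVelocity (fun ε : ℝ => (P.traj (u + ε • v) t).1) (P.variation O q x u t v).1 ∧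
      HasDerivAt (fun ε : ℝ => (P.traj (u + ε • v) t).2) (P.variation O q x u t v).2 0
  | 0, _ => ⟨hasVelocity_const _, hasDerivAt_const _ _⟩
  | t + 1, ht => by
    obtain ⟨h1, h2⟩ := hasDerivAt_traj hP hO hs h v t (by omega)
    have h0 : P.traj (u + (0 : ℝ) • v) t = (q t, x t) := by
      rw [zero_smul, add_zero, h.traj_eq t (by omega)]
    have hu : HasDerivAt (fun ε : ℝ => (u + ε • v) t) (v t) 0 := by
      simpa using ((hasDerivAt_id (0 : ℝ)).smul_const (v t)).const_add (u t)
    have hlog := (hP.smooth_log hO hs ht (q t, x t)).hasDerivAt_comp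
      (congrArg Prod.fst h0) (congrArg Prod.snd h0) h1 h2
    refine ⟨?_, ?_⟩
    · have h3 := h1.mul (hO.hasVelocity (fun ε => hs t ht ⟨_, rfl⟩) hlog)
      rw [Prod.mk.eta, h0] at h3
      exact h3
    · exact (hP.smooth_f t ht (q t, x t, u t)).hasDerivAt_comp₃
        (congrArg Prod.fst h0) (congrArg Prod.snd h0) (by simp) h1 h2 hu

/-! ### Derivatives of the Hamiltonian -/

/-- The derivative of an affine function on the dual space is its linear part. -/
theorem dualGrad_eval {V : Type*} [NormedAddCommGroup V] [NormedSpace ℝ V]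
    [FiniteDimensional ℝ V] (v : V) (a b c : ℝ) (ζ : V →L[ℝ] ℝ) :
    dualGrad (fun z : V →L[ℝ] ℝ => a + z v + b + c) ζ = v := by
  rw [SeparatingDual.eq_iff_forall_dual_eq (R := ℝ)]
  intro z
  have h : HasFDerivAt (fun z : V →L[ℝ] ℝ => z v) (ContinuousLinearMap.apply ℝ ℝ v) ζ :=
    (ContinuousLinearMap.apply ℝ ℝ v).hasFDerivAt
  rw [apply_dualGrad, (((h.const_add a).add_const b).add_const c).fderiv]
  rfl

theorem ControlProblem.DζH_eq (η : ℝ) (ηF : E l) (ζ : lieAlg G →L[ℝ] ℝ) (ξ : E d) (t : ℕ)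
    (q : G.toSubgroup) (x : E d) (u : E m) :
    P.DζH O η ηF ζ ξ t q x u = logOn G O (P.s t (q, x)) :=
  dualGrad_eval _ _ _ _ _

theorem ControlProblem.expG_DζH (hs : ∀ t < P.N, Set.range (P.s t) ⊆ expG G '' O)
    (η : ℝ) (ηF : E l) (ζ : lieAlg G →L[ℝ] ℝ) (ξ : E d) {t : ℕ} (ht : t < P.N)
    (q : G.toSubgroup) (x : E d) (u : E m) :
    expG G (P.DζH O η ηF ζ ξ t q x u) = P.s t (q, x) := by
  rw [P.DζH_eq, expG_logOn (hs t ht ⟨_, rfl⟩)]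

theorem inner_gradient {V : Type*} [NormedAddCommGroup V] [InnerProductSpace ℝ V]
    [CompleteSpace V] (φ : V → ℝ) (x y : V) :
    inner ℝ (gradient φ x) y = fderiv ℝ φ x y :=
  InnerProductSpace.toDual_symm_apply

theorem ControlProblem.gradient_H_costate (η : ℝ) (ηF : E l) (ζ : lieAlg G →L[ℝ] ℝ) (ξ : E d)
    (t : ℕ) (q : G.toSubgroup) (x : E d) (u : E m) :
    gradient (fun y => P.H O η ηF ζ y t q x u) ξ = P.f t (q, x, u) := by
  refine ext_inner_right ℝ fun z => ?_
  have h : HasFDerivAt (fun y => P.H O η ηF ζ y t q x u) (innerSL ℝ (P.f t (q, x, u))) ξ := by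
    have e : (fun y => P.H O η ηF ζ y t q x u) = fun y => η * P.c t (q, x, u)
        + ζ (logOn G O (P.s t (q, x))) + innerSL ℝ (P.f t (q, x, u)) y + inner ℝ ηF (P.F t u) := by
      funext y
      rw [innerSL_apply_apply, real_inner_comm]
      rfl
    rw [e]
    exact ((innerSL ℝ (P.f t (q, x, u))).hasFDerivAt.const_add _).add_const _
  rw [inner_gradient, h.fderiv, innerSL_apply_apply]

theorem ControlProblem.trivDeriv_H (hP : P.IsRegular) (hO : IsExpDiffeoOn G O)
    (hs : ∀ t < P.N, Set.range (P.s t) ⊆ expG G '' O)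
    (η : ℝ) (ηF : E l) (ζ : lieAlg G →L[ℝ] ℝ) (ξ : E d) {t : ℕ} (ht : t < P.N)
    (q : G.toSubgroup) (x : E d) (u : E m) (X : lieAlg G) :
    trivDeriv G (fun p => P.H O η ηF ζ ξ t p x u) q X
      = η * trivDeriv G (fun p => P.c t (p, x, u)) q X
        + ζ (trivDeriv G (fun p => logOn G O (P.s t (p, x))) q X)
        + inner ℝ ξ (trivDeriv G (fun p => P.f t (p, x, u)) q X) := by
  have h1 := (hP.smooth_c t ht (q, x, u)).fst.hasFDerivAt_expG
  have h2 := (hP.smooth_log hO hs ht (q, x)).fst.hasFDerivAt_expG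
  have h3 := (hP.smooth_f t ht (q, x, u)).fst.hasFDerivAt_expG
  have h := (((h1.const_mul η).add (ζ.hasFDerivAt.comp (0 : lieAlg G) h2)).add
    ((innerSL ℝ ξ).hasFDerivAt.comp (0 : lieAlg G) h3)).add_const (inner ℝ ηF (P.F t u))
  exact DFunLike.congr_fun h.fderiv X

theorem ControlProblem.inner_gradient_H_state (hP : P.IsRegular) (hO : IsExpDiffeoOn G O)
    (hs : ∀ t < P.N, Set.range (P.s t) ⊆ expG G '' O)
    (η : ℝ) (ηF : E l) (ζ : lieAlg G →L[ℝ] ℝ) (ξ : E d) {t : ℕ} (ht : t < P.N)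
    (q : G.toSubgroup) (x : E d) (u : E m) (z : E d) :
    inner ℝ (gradient (fun y => P.H O η ηF ζ ξ t q y u) x) z
      = η * fderiv ℝ (fun y => P.c t (q, y, u)) x z
        + ζ (fderiv ℝ (fun y => logOn G O (P.s t (q, y))) x z)
        + inner ℝ ξ (fderiv ℝ (fun y => P.f t (q, y, u)) x z) := by
  have hι : ContDiffAt ℝ ∞ (fun y : E d => (y, u)) x := contDiffAt_id.prodMk contDiffAt_const
  have h1 := (((hP.smooth_c t ht (q, x, u)).contDiffAt_snd.comp x hι).differentiableAt
    (by simp)).hasFDerivAt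
  have h2 := ((hP.smooth_log hO hs ht (q, x)).contDiffAt_snd.differentiableAt
    (by simp)).hasFDerivAt
  have h3 := (((hP.smooth_f t ht (q, x, u)).contDiffAt_snd.comp x hι).differentiableAt
    (by simp)).hasFDerivAt
  have h := (((h1.const_mul η).add (ζ.hasFDerivAt.comp x h2)).add
    ((innerSL ℝ ξ).hasFDerivAt.comp x h3)).add_const (inner ℝ ηF (P.F t u))
  rw [inner_gradient]
  exact DFunLike.congr_fun h.fderiv z

theorem ControlProblem.inner_gradient_H_control (hP : P.IsRegular)
    (η : ℝ) (ηF : E l) (ζ : lieAlg G →L[ℝ] ℝ) (ξ : E d) {t : ℕ} (ht : t < P.N)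
    (q : G.toSubgroup) (x : E d) (u : E m) (v : E m) :
    inner ℝ (gradient (fun w => P.H O η ηF ζ ξ t q x w) u) v
      = η * fderiv ℝ (fun w => P.c t (q, x, w)) u v
        + inner ℝ ξ (fderiv ℝ (fun w => P.f t (q, x, w)) u v) + inner ℝ ηF (P.F t v) := by
  have hι : ContDiffAt ℝ ∞ (fun w : E m => (x, w)) u := contDiffAt_const.prodMk contDiffAt_id
  have h1 := (((hP.smooth_c t ht (q, x, u)).contDiffAt_snd.comp u hι).differentiableAt
    (by simp)).hasFDerivAt
  have h3 := (((hP.smooth_f t ht (q, x, u)).contDiffAt_snd.comp u hι).differentiableAt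
    (by simp)).hasFDerivAt
  have h := (((h1.const_mul η).add_const (ζ (logOn G O (P.s t (q, x))))).add
    ((innerSL ℝ ξ).hasFDerivAt.comp u h3)).add
    ((innerSL ℝ ηF).hasFDerivAt.comp u (P.F t).hasFDerivAt)
  rw [inner_gradient]
  exact DFunLike.congr_fun h.fderiv v

theorem trivDeriv_inner {f : G.toSubgroup → E r} {q : G.toSubgroup}
    (hf : SmoothAlongAt (toMat G) f q) (ν : E r) (X : lieAlg G) :
    trivDeriv G (fun p => inner ℝ ν (f p)) q X = inner ℝ ν (trivDeriv G f q X) :=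
  DFunLike.congr_fun ((innerSL ℝ ν).hasFDerivAt.comp (0 : lieAlg G) hf.hasFDerivAt_expG).fderiv X

theorem inner_gradient_inner {V : Type*} [NormedAddCommGroup V] [InnerProductSpace ℝ V]
    [CompleteSpace V] {f : V → E r} {x : V} (hf : DifferentiableAt ℝ f x) (ν : E r) (z : V) :
    inner ℝ (gradient (fun y => inner ℝ ν (f y)) x) z = inner ℝ ν (fderiv ℝ f x z) := by
  rw [inner_gradient]
  exact DFunLike.congr_fun ((innerSL ℝ ν).hasFDerivAt.comp x hf.hasFDerivAt).fderiv z

/-- The differential of a multiplied state constraint, paired with a variation of the state. -/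
theorem SmoothAlongAt.inner_totalDeriv {f : G.toSubgroup × E d → E r} {q : G.toSubgroup} {x : E d}
    (hf : SmoothAlongAt (fun y : G.toSubgroup × E d => (toMat G y.1, y.2)) f (q, x)) (ν : E r)
    (X : lieAlg G × E d) :
    inner ℝ ν (totalDeriv f q x X) = trivDeriv G (fun p => inner ℝ ν (f (p, x))) q X.1
      + inner ℝ (gradient (fun y => inner ℝ ν (f (q, y))) x) X.2 := by
  rw [trivDeriv_inner hf.fst, inner_gradient_inner (hf.contDiffAt_snd.differentiableAt (by simp)),
    totalDeriv, ContinuousLinearMap.coprod_apply, inner_add_right]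

/-! ### Duality between the variation and the costates -/

/-- One step of the summation by parts: the differential of the Hamiltonian in all its variables,
in terms of the linearized dynamics. -/
theorem ControlProblem.hamiltonian_stage (hP : P.IsRegular) (hO : IsExpDiffeoOn G O)
    (hs : ∀ t < P.N, Set.range (P.s t) ⊆ expG G '' O)
    (η : ℝ) (ηF : E l) (ρ : lieAlg G →L[ℝ] ℝ) (ξ : E d) {t : ℕ} (ht : t < P.N)
    (q : G.toSubgroup) (x : E d) (u : E m) (X : lieAlg G × E d) (v : E m)
    {ζ : lieAlg G →L[ℝ] ℝ} (hζ : ζ = ρ.comp (dlogOn G O (P.s t (q, x))).inverse) :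
    trivDeriv G (fun p => P.H O η ηF ζ ξ t p x u) q X.1
        + AdDual G (P.s t (q, x))⁻¹ ρ X.1
        + inner ℝ (gradient (fun y => P.H O η ηF ζ ξ t q y u) x) X.2
        + inner ℝ (gradient (fun w => P.H O η ηF ζ ξ t q x w) u) v
      = η * totalDeriv₃ (P.c t) q x u (X, v) + inner ℝ ηF (P.F t v)
        + (ρ (P.linStep O t q x u (X, v)).1 + inner ℝ ξ (P.linStep O t q x u (X, v)).2) := by
  rw [P.trivDeriv_H hP hO hs η ηF ζ ξ ht, P.inner_gradient_H_state hP hO hs η ηF ζ ξ ht,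
    P.inner_gradient_H_control hP η ηF ζ ξ ht]
  simp only [ControlProblem.linStep, totalDeriv, totalDeriv₃, ContinuousLinearMap.prod_apply,
    ContinuousLinearMap.coprod_apply, add_apply, ContinuousLinearMap.comp_apply,
    ContinuousLinearMap.coe_fst', inner_add_right, map_add, AdDual, hζ]
  ring

/-- Summation by parts along the trajectory: if the costates satisfy the adjoint equation, the
differential of the Hamiltonian in the controls is the differential of the Lagrangian of the
problem, seen as a problem in the controls only. -/
theorem ControlProblem.sum_gradient_control (hP : P.IsRegular) (hO : IsExpDiffeoOn G O)
    (hs : ∀ t < P.N, Set.range (P.s t) ⊆ expG G '' O) {q : ℕ → G.toSubgroup} {x : ℕ → E d}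
    {u : ℕ → E m} {ζ ρ : ℕ → lieAlg G →L[ℝ] ℝ} {ξ : ℕ → E d} {μ : ℕ → E r} {η : ℝ} {ηF : E l}
    (hζ : ∀ t < P.N, ζ t = (ρ t).comp (dlogOn G O (P.s t (q t, x t))).inverse)
    (hadj_q : ∀ t, 1 ≤ t → t < P.N → ρ (t - 1) =
      trivDeriv G (fun p => P.H O η ηF (ζ t) (ξ t) t p (x t) (u t)) (q t)
        + trivDeriv G (fun p => inner ℝ (μ t) (P.g t (p, x t))) (q t)
        + AdDual G (P.s t (q t, x t))⁻¹ (ρ t))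
    (hadj_x : ∀ t, 1 ≤ t → t < P.N → ξ (t - 1) =
      gradient (fun y => P.H O η ηF (ζ t) (ξ t) t (q t) y (u t)) (x t)
        + gradient (fun y => inner ℝ (μ t) (P.g t (q t, y))) (x t))
    (htr_q : ρ (P.N - 1) = η • trivDeriv G (fun p => P.cN (p, x P.N)) (q P.N)
      + trivDeriv G (fun p => inner ℝ (μ P.N) (P.g P.N (p, x P.N))) (q P.N))
    (htr_x : ξ (P.N - 1) = η • gradient (fun y => P.cN (q P.N, y)) (x P.N)
      + gradient (fun y => inner ℝ (μ P.N) (P.g P.N (q P.N, y))) (x P.N))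
    (v : ℕ → E m) :
    ∑ t ∈ Finset.range P.N,
        inner ℝ (gradient (fun w => P.H O η ηF (ζ t) (ξ t) t (q t) (x t) w) (u t)) (v t)
      = η * (∑ t ∈ Finset.range P.N,
            totalDeriv₃ (P.c t) (q t) (x t) (u t) (P.variation O q x u t v, v t)
          + totalDeriv P.cN (q P.N) (x P.N) (P.variation O q x u P.N v))
        + ∑ t ∈ Finset.range P.N, inner ℝ (μ (t + 1))
            (totalDeriv (P.g (t + 1)) (q (t + 1)) (x (t + 1)) (P.variation O q x u (t + 1) v))
        + inner ℝ ηF (∑ t ∈ Finset.range P.N, P.F t (v t)) := by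
  have key : ∀ k, k + 1 ≤ P.N → ∑ t ∈ Finset.range (k + 1),
        inner ℝ (gradient (fun w => P.H O η ηF (ζ t) (ξ t) t (q t) (x t) w) (u t)) (v t)
      = η * (∑ t ∈ Finset.range (k + 1),
            totalDeriv₃ (P.c t) (q t) (x t) (u t) (P.variation O q x u t v, v t))
        + ∑ t ∈ Finset.range k, inner ℝ (μ (t + 1))
            (totalDeriv (P.g (t + 1)) (q (t + 1)) (x (t + 1)) (P.variation O q x u (t + 1) v))
        + inner ℝ ηF (∑ t ∈ Finset.range (k + 1), P.F t (v t))
        + (ρ k (P.variation O q x u (k + 1) v).1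
          + inner ℝ (ξ k) (P.variation O q x u (k + 1) v).2) := by
    intro k
    induction k with
    | zero =>
      intro hk
      -- the initial state is fixed, so its variation vanishes and no adjoint equation is needed
      have h := P.hamiltonian_stage hP hO hs η ηF (ρ 0) (ξ 0) hk (q 0) (x 0) (u 0) 0 (v 0)
        (hζ 0 hk)
      simp only [Prod.fst_zero, Prod.snd_zero, map_zero, inner_zero_right, zero_add] at h
      simp only [zero_add, Finset.sum_range_one, Finset.sum_range_zero, add_zero]
      exact h
    | succ k ih =>
      intro hk
      have h := P.hamiltonian_stage hP hO hs η ηF (ρ (k + 1)) (ξ (k + 1)) hk (q (k + 1))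
        (x (k + 1)) (u (k + 1)) (P.variation O q x u (k + 1) v) (v (k + 1)) (hζ (k + 1) hk)
      have hq := hadj_q (k + 1) (by omega) hk
      have hx := hadj_x (k + 1) (by omega) hk
      rw [Nat.add_sub_cancel] at hq hx
      have hμ := (hP.smooth_g (k + 1) (by omega) (by omega) (q (k + 1), x (k + 1))).inner_totalDeriv
        (μ (k + 1)) (P.variation O q x u (k + 1) v)
      rw [Finset.sum_range_succ, ih (by omega), hq, hx, Finset.sum_range_succ _ (k + 1),
        Finset.sum_range_succ (fun t => (inner ℝ (μ (t + 1))
          (totalDeriv (P.g (t + 1)) (q (t + 1)) (x (t + 1)) (P.variation O q x u (t + 1) v)) : ℝ)) k,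
        Finset.sum_range_succ _ (k + 1), hμ,
        P.variation_succ q x u v (k + 1)]
      simp only [add_apply, inner_add_left, inner_add_right, mul_add]
      linarith
  obtain ⟨M, hM⟩ : ∃ M, P.N = M + 1 := ⟨P.N - 1, by have := hP.N_pos; omega⟩
  have h := key M hM.ge
  rw [hM, Nat.add_sub_cancel] at htr_q htr_x
  have hμ := (hP.smooth_g (M + 1) (by omega) hM.ge (q (M + 1), x (M + 1))).inner_totalDeriv
    (μ (M + 1)) (P.variation O q x u (M + 1) v)
  rw [hM, h, Finset.sum_range_succ (fun t => (inner ℝ (μ (t + 1))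
          (totalDeriv (P.g (t + 1)) (q (t + 1)) (x (t + 1)) (P.variation O q x u (t + 1) v)) : ℝ)) M,
    hμ, htr_q, htr_x]
  simp only [totalDeriv, ContinuousLinearMap.coprod_apply, add_apply,
    smul_apply, inner_add_left, real_inner_smul_left, inner_gradient,
    smul_eq_mul]
  ring

/-- Sequences may be defined backwards from their value at `N - 1`. -/
theorem exists_backward {X : Type*} (N : ℕ) (a : X) (Φ : ℕ → X → X) :
    ∃ κ : ℕ → X, κ (N - 1) = a ∧ ∀ t, 1 ≤ t → t < N → κ (t - 1) = Φ t (κ t) := by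
  refine ⟨fun t => Nat.rec a (fun k y => Φ (N - 1 - k) y) (N - 1 - t), by simp, ?_⟩
  intro t h1 h2
  have e : N - 1 - (t - 1) = (N - 1 - t) + 1 := by omega
  have e' : N - 1 - (N - 1 - t) = t := by omega
  simp only [e, e']

/-! ### The maximum principle -/

theorem ControlProblem.hasDerivAt_cost (hP : P.IsRegular) (hO : IsExpDiffeoOn G O)
    (hs : ∀ t < P.N, Set.range (P.s t) ⊆ expG G '' O) {q : ℕ → G.toSubgroup} {x : ℕ → E d}
    {u : ℕ → E m} (h : P.IsFeasible q x u) (v : ℕ → E m) :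
    HasDerivAt (fun ε : ℝ => P.cost (fun t => (P.traj (u + ε • v) t).1)
        (fun t => (P.traj (u + ε • v) t).2) (u + ε • v))
      (∑ t ∈ Finset.range P.N,
          totalDeriv₃ (P.c t) (q t) (x t) (u t) (P.variation O q x u t v, v t)
        + totalDeriv P.cN (q P.N) (x P.N) (P.variation O q x u P.N v)) 0 := by
  have h0 : ∀ t ≤ P.N, P.traj (u + (0 : ℝ) • v) t = (q t, x t) := fun t ht => by
    rw [zero_smul, add_zero, h.traj_eq t ht]
  refine HasDerivAt.add (HasDerivAt.fun_sum fun t ht => ?_) ?_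
  · have ht := Finset.mem_range.1 ht
    obtain ⟨h1, h2⟩ := P.hasDerivAt_traj hP hO hs h v t ht.le
    have hu : HasDerivAt (fun ε : ℝ => (u + ε • v) t) (v t) 0 := by
      simpa using ((hasDerivAt_id (0 : ℝ)).smul_const (v t)).const_add (u t)
    exact (hP.smooth_c t ht (q t, x t, u t)).hasDerivAt_comp₃ (congrArg Prod.fst (h0 t ht.le))
      (congrArg Prod.snd (h0 t ht.le)) (by simp) h1 h2 hu
  · obtain ⟨h1, h2⟩ := P.hasDerivAt_traj hP hO hs h v P.N le_rfl
    exact (hP.smooth_cN (q P.N, x P.N)).hasDerivAt_comp (congrArg Prod.fst (h0 _ le_rfl))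
      (congrArg Prod.snd (h0 _ le_rfl)) h1 h2

/-- The Lagrange multipliers of the problem seen as a problem in the controls only. -/
theorem ControlProblem.IsOptimal.exists_multipliers (hP : P.IsRegular) (hO : IsExpDiffeoOn G O)
    (hs : ∀ t < P.N, Set.range (P.s t) ⊆ expG G '' O) {q : ℕ → G.toSubgroup} {x : ℕ → E d}
    {u : ℕ → E m} (hopt : P.IsOptimal q x u) :
    ∃ (η : ℝ) (μ : ℕ → E r) (ηF : E l), (η = -1 ∨ η = 0) ∧
      (∀ t, 1 ≤ t → t ≤ P.N → ∀ j, μ t j ≤ 0) ∧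
      (∀ t, 1 ≤ t → t ≤ P.N → ∀ j, μ t j * P.g t (q t, x t) j = 0) ∧
      ¬ (η = 0 ∧ ηF = 0 ∧ ∀ t, 1 ≤ t → t ≤ P.N → μ t = 0) ∧
      ∀ w : ℕ → E m, (∀ t < P.N, w t ∈ P.U t) →
        η * (∑ t ∈ Finset.range P.N,
              totalDeriv₃ (P.c t) (q t) (x t) (u t) (P.variation O q x u t (w - u), (w - u) t)
            + totalDeriv P.cN (q P.N) (x P.N) (P.variation O q x u P.N (w - u)))
          + ∑ t ∈ Finset.range P.N, inner ℝ (μ (t + 1))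
              (totalDeriv (P.g (t + 1)) (q (t + 1)) (x (t + 1))
                (P.variation O q x u (t + 1) (w - u)))
          + inner ℝ ηF (∑ t ∈ Finset.range P.N, P.F t ((w - u) t)) ≤ 0 := by
  obtain ⟨hfeas, hmin⟩ := hopt
  have htraj := hfeas.traj_eq
  let K : Set (ℕ → E m) := {w | ∀ t < P.N, w t ∈ P.U t}
  have hK : Convex ℝ K := fun w hw w' hw' a b ha hb hab t ht =>
    hP.convex_U t ht (hw t ht) (hw' t ht) ha hb hab
  let J' : (ℕ → E m) →ₗ[ℝ] ℝ :=
    ∑ t ∈ Finset.range P.N, (totalDeriv₃ (P.c t) (q t) (x t) (u t)).toLinearMap ∘ₗ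
        (P.variation O q x u t).prod (LinearMap.proj t)
      + (totalDeriv P.cN (q P.N) (x P.N)).toLinearMap ∘ₗ P.variation O q x u P.N
  have hJ'apply : ∀ v, J' v = ∑ t ∈ Finset.range P.N,
        totalDeriv₃ (P.c t) (q t) (x t) (u t) (P.variation O q x u t v, v t)
      + totalDeriv P.cN (q P.N) (x P.N) (P.variation O q x u P.N v) := fun v => by
    simp [J', LinearMap.sum_apply]
  let g' : Fin P.N × Fin r → (ℕ → E m) →ₗ[ℝ] ℝ := fun i =>
    ((EuclideanSpace.proj i.2).comp
      (totalDeriv (P.g (i.1 + 1)) (q (i.1 + 1)) (x (i.1 + 1)))).toLinearMap ∘ₗ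
        P.variation O q x u (i.1 + 1)
  let L : (ℕ → E m) →ₗ[ℝ] E l :=
    ∑ t ∈ Finset.range P.N, (P.F t).toLinearMap ∘ₗ LinearMap.proj t
  have hL : ∀ v, L v = ∑ t ∈ Finset.range P.N, P.F t (v t) := fun v => by
    simp [L, LinearMap.sum_apply]
  have hcost : P.cost (fun t => (P.traj u t).1) (fun t => (P.traj u t).2) u = P.cost q x u := by
    unfold ControlProblem.cost
    congr 1
    · refine Finset.sum_congr rfl fun t ht => ?_
      simp only [htraj t (Finset.mem_range.1 ht).le]
    · simp only [htraj P.N le_rfl]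
  obtain ⟨η, μ, ηF, hη, hμ, hsl, hne, hle⟩ := exists_fritzJohn_multipliers hK (u := u)
    (J := fun w => P.cost (fun t => (P.traj w t).1) (fun t => (P.traj w t).2) w) (J' := J')
    (g := fun (i : Fin P.N × Fin r) w => P.g (i.1 + 1) (P.traj w (i.1 + 1)) i.2) (g' := g')
    (L := L) hfeas.control
    (fun v => by rw [hJ'apply]; exact P.hasDerivAt_cost hP hO hs hfeas v)
    (fun i v => by
      have hi : (i.1 : ℕ) + 1 ≤ P.N := i.1.2
      obtain ⟨h1, h2⟩ := P.hasDerivAt_traj hP hO hs hfeas v _ hi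
      have h0 : P.traj (u + (0 : ℝ) • v) (i.1 + 1) = (q (i.1 + 1), x (i.1 + 1)) := by
        rw [zero_smul, add_zero, htraj _ hi]
      have h3 := (hP.smooth_g (i.1 + 1) (by omega) hi (q (i.1 + 1), x (i.1 + 1))).hasDerivAt_comp
        (congrArg Prod.fst h0) (congrArg Prod.snd h0) h1 h2
      exact (EuclideanSpace.proj (𝕜 := ℝ) i.2).hasFDerivAt.comp_hasDerivAt (0 : ℝ) h3)
    (by rw [hL]; exact hfeas.freq)
    (fun i => by
      have hi : (i.1 : ℕ) + 1 ≤ P.N := i.1.2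
      simp only [htraj _ hi]
      exact hfeas.state _ (by omega) hi _)
    (fun w hw hgw hLw => by
      rw [hcost]
      exact hmin _ _ _ (P.isFeasible_traj hw (fun t ht j => hgw (⟨t, ht⟩, j)) (by rw [← hL, hLw])))
  refine ⟨η, fun t => WithLp.toLp 2 fun j => if h : t - 1 < P.N then μ (⟨t - 1, h⟩, j) else 0, ηF,
    hη, fun t h1 h2 j => ?_, fun t h1 h2 j => ?_, ?_, fun w hw => ?_⟩
  · have h : t - 1 < P.N := by omega
    simpa [h] using hμ (⟨t - 1, h⟩, j)
  · have h : t - 1 < P.N := by omega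
    have h3 := hsl (⟨t - 1, h⟩, j)
    simp only [Nat.sub_add_cancel h1, htraj t h2] at h3
    simpa [h] using h3
  · rintro ⟨h1, h2, h3⟩
    refine hne ⟨h1, fun i => ?_, h2⟩
    have h4 := congrArg (fun z : E r => z i.2) (h3 (i.1 + 1) (by omega) i.1.2)
    simpa using h4
  · have h1 := hle w hw
    rw [hJ'apply, hL, Fintype.sum_prod_type] at h1
    have h2 : ∑ i : Fin P.N, ∑ j, μ (i, j) * g' (i, j) (w - u)
        = ∑ t ∈ Finset.range P.N,
          inner ℝ (WithLp.toLp 2 fun j : Fin r => if h : t + 1 - 1 < P.N then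
            μ (⟨t + 1 - 1, h⟩, j) else 0)
          (totalDeriv (P.g (t + 1)) (q (t + 1)) (x (t + 1))
            (P.variation O q x u (t + 1) (w - u))) := by
      rw [Finset.sum_range]
      refine Finset.sum_congr rfl fun i _ => ?_
      simp [g', PiLp.inner_apply, mul_comm]
    rw [h2] at h1
    exact h1

/-- The maximum principle for a closed subgroup of the units of a finite-dimensional algebra. -/
theorem ControlProblem.IsOptimal.exists_isExtremal (hP : P.IsRegular) (hO : IsExpDiffeoOn G O)
    (hs : ∀ t < P.N, Set.range (P.s t) ⊆ expG G '' O) {q : ℕ → G.toSubgroup} {x : ℕ → E d}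
    {u : ℕ → E m} (hopt : P.IsOptimal q x u) :
    ∃ (ζ ρ : ℕ → lieAlg G →L[ℝ] ℝ) (ξ : ℕ → E d) (μ : ℕ → E r) (η : ℝ) (ηF : E l),
      (η = -1 ∨ η = 0) ∧ P.IsExtremal O q x u ζ ρ ξ μ η ηF := by
  obtain ⟨η, μ, ηF, hη, hμ, hsl, hne, hle⟩ := hopt.exists_multipliers hP hO hs
  have hfeas := hopt.1
  -- the covector `ζ t` corresponding to `ρ t`
  let Z : ℕ → (lieAlg G →L[ℝ] ℝ) → lieAlg G →L[ℝ] ℝ := fun t ρ =>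
    ρ.comp (dlogOn G O (P.s t (q t, x t))).inverse
  obtain ⟨κ, hκN, hκ⟩ := exists_backward (X := (lieAlg G →L[ℝ] ℝ) × E d) P.N
    (η • trivDeriv G (fun p => P.cN (p, x P.N)) (q P.N)
        + trivDeriv G (fun p => inner ℝ (μ P.N) (P.g P.N (p, x P.N))) (q P.N),
      η • gradient (fun y => P.cN (q P.N, y)) (x P.N)
        + gradient (fun y => inner ℝ (μ P.N) (P.g P.N (q P.N, y))) (x P.N))
    (fun t κ =>
      (trivDeriv G (fun p => P.H O η ηF (Z t κ.1) κ.2 t p (x t) (u t)) (q t)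
        + trivDeriv G (fun p => inner ℝ (μ t) (P.g t (p, x t))) (q t)
        + AdDual G (P.s t (q t, x t))⁻¹ κ.1,
      gradient (fun y => P.H O η ηF (Z t κ.1) κ.2 t (q t) y (u t)) (x t)
        + gradient (fun y => inner ℝ (μ t) (P.g t (q t, y))) (x t)))
  let ρ : ℕ → lieAlg G →L[ℝ] ℝ := fun t => (κ t).1
  let ξ : ℕ → E d := fun t => (κ t).2
  let ζ : ℕ → lieAlg G →L[ℝ] ℝ := fun t => Z t (ρ t)
  have hh : ∀ t < P.N, P.s t (q t, x t) ∈ expG G '' O := fun t ht => hs t ht ⟨_, rfl⟩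
  have hρζ : ∀ t < P.N, ρ t = (ζ t).comp (dlogOn G O (P.s t (q t, x t))) := fun t ht => by
    change ρ t = ((ρ t).comp _).comp _
    rw [ContinuousLinearMap.comp_assoc, hO.inverse_comp_dlogOn (hh t ht),
      ContinuousLinearMap.comp_id]
  have hadj_q : ∀ t, 1 ≤ t → t < P.N → ρ (t - 1) =
      trivDeriv G (fun p => P.H O η ηF (ζ t) (ξ t) t p (x t) (u t)) (q t)
        + trivDeriv G (fun p => inner ℝ (μ t) (P.g t (p, x t))) (q t)
        + AdDual G (P.s t (q t, x t))⁻¹ (ρ t) := fun t h1 h2 => congrArg Prod.fst (hκ t h1 h2)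
  have hadj_x : ∀ t, 1 ≤ t → t < P.N → ξ (t - 1) =
      gradient (fun y => P.H O η ηF (ζ t) (ξ t) t (q t) y (u t)) (x t)
        + gradient (fun y => inner ℝ (μ t) (P.g t (q t, y))) (x t) :=
    fun t h1 h2 => congrArg Prod.snd (hκ t h1 h2)
  have htr_q : ρ (P.N - 1) = η • trivDeriv G (fun p => P.cN (p, x P.N)) (q P.N)
      + trivDeriv G (fun p => inner ℝ (μ P.N) (P.g P.N (p, x P.N))) (q P.N) :=
    congrArg Prod.fst hκN
  have htr_x : ξ (P.N - 1) = η • gradient (fun y => P.cN (q P.N, y)) (x P.N)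
      + gradient (fun y => inner ℝ (μ P.N) (P.g P.N (q P.N, y))) (x P.N) :=
    congrArg Prod.snd hκN
  have hsum := P.sum_gradient_control hP hO hs (fun t _ => rfl) hadj_q hadj_x htr_q htr_x
  refine ⟨ζ, ρ, ξ, μ, η, ηF, hη, ?_⟩
  exact {
    rho_eq := fun t ht => by rw [P.expG_DζH hs η ηF _ _ ht]; exact hρζ t ht
    nontrivial := fun ⟨_, _, h3, h4, h5⟩ => hne ⟨h3, h4, h5⟩
    nontrivial_of_nondegenerate := by
      rintro hnd ⟨hξ0, hζ0, hη0, hηF0⟩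
      have hρ0 : ∀ t < P.N, ρ t = 0 := fun t ht => by
        rw [hρζ t ht, hζ0 t ht, ContinuousLinearMap.zero_comp]
      refine hne ⟨hη0, hηF0, fun t h1 h2 => hnd t h1 h2 (μ t) (hμ t h1 h2) (hsl t h1 h2) ?_ ?_⟩
      · rcases h2.lt_or_eq with h | rfl
        · have e := hadj_q t h1 h
          have hH : trivDeriv G (fun p => P.H O η ηF (ζ t) (ξ t) t p (x t) (u t)) (q t) = 0 := by
            simp [ControlProblem.H, trivDeriv, hη0, hζ0 t h, hξ0 t h]
          have hA : AdDual G (P.s t (q t, x t))⁻¹ (ρ t) = 0 := by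
            rw [hρ0 t h, AdDual, ContinuousLinearMap.zero_comp]
          rw [hρ0 _ (by omega), hH, hA, zero_add, add_zero] at e
          exact e.symm
        · rw [hρ0 _ (by omega), hη0, zero_smul, zero_add] at htr_q
          exact htr_q.symm
      · rcases h2.lt_or_eq with h | rfl
        · have e := hadj_x t h1 h
          have hH : gradient (fun y => P.H O η ηF (ζ t) (ξ t) t (q t) y (u t)) (x t) = 0 := by
            simp [ControlProblem.H, gradient, hη0, hζ0 t h, hξ0 t h]
          rw [hξ0 _ (by omega), hH, zero_add] at e
          exact e.symm
        · rw [hξ0 _ (by omega), hη0, zero_smul, zero_add] at htr_x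
          exact htr_x.symm
    state_q := fun t ht => by rw [P.expG_DζH hs η ηF _ _ ht]; exact hfeas.step_q t ht
    state_x := fun t ht => by rw [P.gradient_H_costate]; exact hfeas.step_x t ht
    adjoint_q := fun t h1 h2 => by
      rw [expG_neg, P.expG_DζH hs η ηF _ _ h2]; exact hadj_q t h1 h2
    adjoint_x := hadj_x
    transversality_q := htr_q
    transversality_x := htr_x
    hamiltonian_le := fun t ht v hv => by
      -- vary the control at stage `t` only
      have h1 := hle (Function.update u t v) fun k hk => by
        rcases eq_or_ne k t with rfl | hkt
        · rwa [Function.update_self]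
        · rw [Function.update_of_ne hkt]; exact hfeas.control k hk
      rw [← hsum, Finset.sum_eq_single_of_mem t (Finset.mem_range.2 ht)] at h1
      · simpa using h1
      · intro k _ hkt
        simp [Function.update_of_ne hkt]
    slackness := hsl
    nonpos := hμ }

end Principle

end LiePMP

end

/-- The discrete-time maximum principle on a matrix Lie group `G`, a closed subgroup of
`GL(n, 𝕜)` with `𝕜 = ℝ` or `ℂ`, with state constraints and frequency constraints. -/
theorem theorem1 {𝕜 : Type*} [RCLike 𝕜] {n d m r l : ℕ}
    (G : LiePMP.MatrixLieGroup (Matrix (Fin n) (Fin n) 𝕜))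
    (P : LiePMP.ControlProblem G d m r l) (hP : P.IsRegular)
    (O : Set (LiePMP.lieAlg G)) (hO : LiePMP.IsExpDiffeoOn G O)
    (hs : ∀ t < P.N, Set.range (P.s t) ⊆ LiePMP.expG G '' O)
    (q : ℕ → G.toSubgroup) (x : ℕ → LiePMP.E d) (u : ℕ → LiePMP.E m)
    (hopt : P.IsOptimal q x u) :
    ∃ (ζ ρ : ℕ → LiePMP.lieAlg G →L[ℝ] ℝ) (ξ : ℕ → LiePMP.E d) (μ : ℕ → LiePMP.E r)
      (η : ℝ) (ηF : LiePMP.E l),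
      (η = -1 ∨ η = 0) ∧ P.IsExtremal O q x u ζ ρ ξ μ η ηF := by
  exact hopt.exists_isExtremal hP hO hs
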